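/- Let $\mu$ be a probability distribution on $\{0,1\}^n$ and $\xi=(\xi_1,\dots,\xi_n)\sim\mu$ (no homogeneity is assumed). For $\Lambda\subseteq[n]$ and $\sigma\in\{0,1\}^\Lambda$, the two-sided influence matrix $\Psi_\mu^{\sigma}\in\mathbb R^{n\times n}$ has entries $$\Psi_\mu^{\sigma}(i,j)=\Pr[\xi_j=1\mid \xi_i=1,\ \xi_\Lambda=\sigma]-\Pr[\xi_j=1\mid \xi_i=0,\ \xi_\Lambda=\sigma]$$ if both conditioning events have nonzero probability, and $\Psi_\mu^{\sigma}(i,j)=0$ otherwise. The distribution $\mu$ is called two-sided $\ell_\infty$-independent with parameter $D$ if $\|\Psi_\mu^{\sigma}\|_\infty=\max_i\sum_j|\Psi_\mu^{\sigma}(i,j)|\le D$ for all $\Lambda\subseteq[n]$ and $\sigma\in\{0,1\}^\Lambda$. There is an absolute constant $C>0$ such that the following holds for all $n\ge 0$ and $d\ge 1$. Let $\mu$ be a distribution on $\{0,1\}^n$ that is two-sided $\ell_\infty$-independent with parameter $D>0$, let $R>0$, and let $Y_1,\dots,Y_n\in\mathbb R^{d\times d}$ be symmetric matrices with $0\preceq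 Y_i\preceq R\,I$ for all $i$. Put $\mu_{\min}=\lambda_{\min}\big(\mathbb E[\sum_i\xi_iY_i]\big)$ and $\mu_{\max}=\lambda_{\max}\big(\mathbb E[\sum_i\xi_iY_i]\big)$. Then for every $\delta\in[0,1]$ $$\Pr\Big[\lambda_{\min}\Big(\sum_i\xi_iY_i\Big)\le(1-\delta)\,\mu_{\min}\Big]\le d\exp\Big(-\frac{\delta^2\mu_{\min}}{C R D^2}\Big)$$ and $$\Pr\Big[\lambda_{\max}\Big(\sum_i\xi_iY_i-\mathbb E\Big[\sum_i\xi_iY_i\Big]\Big)\ge\delta\,\mu_{\max}\Big]\le d\exp\Big(-\frac{\delta^2\mu_{\max}}{C R D^2}\Big).$$ -/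

import Mathlib

open MeasureTheory ProbabilityTheory

noncomputable section

namespace MatrixChernoff

/-- The event that the coordinates in `Λ` take the values prescribed by `σ`. -/
def pinned {n : ℕ} (Λ : Finset (Fin n)) (σ : Λ → Bool) : Set (Fin n → Bool) :=
  {x | ∀ l : Λ, x l = σ l}

open Classical in
/-- The two-sided influence matrix of a distribution `μ` on `{0,1}^n` under the pinning `σ` of the
coordinates in `Λ`: the entry `(i, j)` is
`P(ξ_j = 1 | ξ_i = 1, ξ_Λ = σ) - P(ξ_j = 1 | ξ_i = 0, ξ_Λ = σ)` if both events that are conditioned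
on have nonzero probability, and `0` otherwise. -/
def twoSidedInfluence {n : ℕ} (μ : Measure (Fin n → Bool)) (Λ : Finset (Fin n)) (σ : Λ → Bool) :
    Matrix (Fin n) (Fin n) ℝ :=
  Matrix.of fun i j =>
    if μ ({x | x i = true} ∩ pinned Λ σ) ≠ 0 ∧ μ ({x | x i = false} ∩ pinned Λ σ) ≠ 0 then
      (cond μ ({x | x i = true} ∩ pinned Λ σ)).real {x | x j = true}
        - (cond μ ({x | x i = false} ∩ pinned Λ σ)).real {x | x j = true}
    else 0

/-- The `ℓ∞` norm of a matrix, that is, its maximal absolute row sum. -/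
def linftyNorm {n : ℕ} (A : Matrix (Fin n) (Fin n) ℝ) : ℝ :=
  ⨆ i, ∑ j, |A i j|

/-- Two-sided `ℓ∞`-independence of a distribution on `{0,1}^n` with parameter `D`. -/
def TwoSidedLinftyIndependent {n : ℕ} (μ : Measure (Fin n → Bool)) (D : ℝ) : Prop :=
  ∀ (Λ : Finset (Fin n)) (σ : Λ → Bool), linftyNorm (twoSidedInfluence μ Λ σ) ≤ D

/-- The largest eigenvalue of a real symmetric matrix of positive size. -/
def lambdaMax {d : ℕ} (A : Matrix (Fin d) (Fin d) ℝ) : ℝ := sSup (spectrum ℝ A)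

/-- The smallest eigenvalue of a real symmetric matrix of positive size. -/
def lambdaMin {d : ℕ} (A : Matrix (Fin d) (Fin d) ℝ) : ℝ := sInf (spectrum ℝ A)

/-- The matrix `∑ i, ξ_i Y_i` at the outcome `ξ = x`. -/
def matSum {n d : ℕ} (Y : Fin n → Matrix (Fin d) (Fin d) ℝ) (x : Fin n → Bool) :
    Matrix (Fin d) (Fin d) ℝ :=
  ∑ i, (if x i = true then (1 : ℝ) else 0) • Y i

/-- The expectation of `∑ i, ξ_i Y_i` for `ξ ∼ μ`, taken entrywise. -/
def meanMatSum {n d : ℕ} (μ : Measure (Fin n → Bool)) (Y : Fin n → Matrix (Fin d) (Fin d) ℝ) :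
    Matrix (Fin d) (Fin d) ℝ :=
  Matrix.of fun a b => ∫ x, matSum Y x a b ∂μ

end MatrixChernoff

end

noncomputable section

set_option linter.unusedSectionVars false

namespace MatrixChernoff

/-! ### Lie product formula in a Banach algebra. -/

section Trotter

open Filter Topology NormedSpace

variable {𝔸 : Type*} [NormedRing 𝔸] [NormOneClass 𝔸]

/-! The coordinates are revealed in uniformly random order and a compensated matrix exponential
moment is followed. With `p` the current conditional means and `N` the unrevealed coordinates, the
exponent is the conditional mean of `θ ∑ ξ_j Y_j` shifted by a constant, plus the compensator `α
∑_{j ∈ N} p_j Y_j`. Its trace exponential is a supermartingale.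

Revealing `i` with deviation `s ∈ {1 - p_i, -p_i}` adds `s L_i - α p_i Y_i`, where `L_i` is a
combination of the `Y_j` along row `i` of the influence matrix. By Golden–Thompson and `exp B ≤ 1 +
B + B²` for `B ≤ 1`, it suffices that `B + B²`, averaged over `i` and `ξ_i`, is `≤ 0`. Matrix
Cauchy–Schwarz and `Y_j² ≤ R Y_j` bound `p_i (1 - p_i) L_i²` by `(|θ| + α)² D R ∑_j |c_ij| Y_j`,
with `c` the conditional covariance. Since `c` is symmetric, its column sums obey the row bound `D
p_j (1 - p_j)`, so after summing over `i ∈ N` the second order terms are paid for by the compensator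
drift `-α ∑ p_j Y_j`. This is why the order is random: a single `L_i²` involves all `Y_j`, not just
`Y_i`.

Running this to the end (`sum_restrictTo_mul_trace_exp_le`) bounds `E tr exp(θ(S - M))` by `tr exp(α
M)`, where `S = ∑ ξ_j Y_j` and `M = E S`, and Markov gives the upper tail. For the lower tail, the
`Y_j` are first conjugated so that `M` becomes the identity; otherwise `λ_max(M)` would enter
instead of `λ_min(M)`. These arguments use `D ≥ 1`. If `D < 1` the distribution is a point mass,
because a nondegenerate coordinate has influence `1` on itself. -/

theorem norm_pow_sub_pow_le {x y : 𝔸} {c : ℝ} (hx : ‖x‖ ≤ c) (hy : ‖y‖ ≤ c) (hc : 1 ≤ c) (N : ℕ) :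
    ‖x ^ N - y ^ N‖ ≤ N * c ^ N * ‖x - y‖ := by
  have hc0 : 0 ≤ c := zero_le_one.trans hc
  induction N with
  | zero => simp
  | succ N ih =>
    have h : x ^ (N + 1) - y ^ (N + 1) = x ^ N * (x - y) + (x ^ N - y ^ N) * y := by
      rw [pow_succ, pow_succ]; noncomm_ring
    have h1 : ‖x ^ N * (x - y)‖ ≤ c ^ N * ‖x - y‖ :=
      (norm_mul_le _ _).trans <| by
        gcongr
        exact (norm_pow_le x N).trans (by gcongr)
    have h2 : ‖(x ^ N - y ^ N) * y‖ ≤ N * c ^ N * ‖x - y‖ * c :=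
      (norm_mul_le _ _).trans (by gcongr)
    have h3 : c ^ N * ‖x - y‖ ≤ c ^ N * ‖x - y‖ * c := le_mul_of_one_le_right (by positivity) hc
    rw [h]
    refine (norm_add_le _ _).trans ?_
    push_cast
    calc _ ≤ c ^ N * ‖x - y‖ * c + N * c ^ N * ‖x - y‖ * c := by linarith
      _ = _ := by ring

variable [NormedAlgebra ℝ 𝔸] [CompleteSpace 𝔸]

theorem norm_exp_le_exp_norm (x : 𝔸) : ‖exp x‖ ≤ Real.exp ‖x‖ := by
  have h := exp_series_hasSum_exp' (𝕂 := ℝ) x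
  have h' : HasSum (fun n : ℕ => ((n.factorial : ℝ)⁻¹) • ‖x‖ ^ n) (Real.exp ‖x‖) := by
    rw [Real.exp_eq_exp_ℝ]
    exact exp_series_hasSum_exp' (𝕂 := ℝ) ‖x‖
  rw [← h.tsum_eq, ← h'.tsum_eq]
  refine tsum_of_norm_bounded h'.summable.hasSum fun n => ?_
  rw [norm_smul, smul_eq_mul, Real.norm_of_nonneg (by positivity)]
  gcongr
  exact norm_pow_le x n

/-- The **Lie product formula**. -/
theorem tendsto_exp_mul_exp_pow (A B : 𝔸) :
    Tendsto (fun N : ℕ => (exp ((N : ℝ)⁻¹ • A) * exp ((N : ℝ)⁻¹ • B)) ^ N) atTop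
      (𝓝 (exp (A + B))) := by
  -- The two curves agree to first order at `0`, so at `t = 1/N` they differ by `o(1/N)`; taking
  -- `N`-th powers multiplies the error by at most `N exp K`.
  have hF : HasDerivAt (fun t : ℝ => exp (t • A) * exp (t • B) - exp (t • (A + B))) 0 0 := by
    have h := ((hasDerivAt_exp_smul_const A (0 : ℝ)).mul (hasDerivAt_exp_smul_const B (0 : ℝ))).sub
      (hasDerivAt_exp_smul_const (A + B) (0 : ℝ))
    refine (h.congr_deriv ?_).congr_of_eventuallyEq (Eventually.of_forall fun t => rfl)
    simp
  have hinv : Tendsto (fun N : ℕ => (N : ℝ)⁻¹) atTop (𝓝 0) := tendsto_inv_atTop_nhds_zero_nat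
  have hlo : (fun N : ℕ => exp ((N : ℝ)⁻¹ • A) * exp ((N : ℝ)⁻¹ • B)
      - exp ((N : ℝ)⁻¹ • (A + B))) =o[atTop] fun N : ℕ => (N : ℝ)⁻¹ := by
    have h := hF.isLittleO.comp_tendsto hinv
    simpa [Function.comp_def] using h
  have hlim : Tendsto (fun N : ℕ => (N : ℝ) * ‖exp ((N : ℝ)⁻¹ • A) * exp ((N : ℝ)⁻¹ • B)
      - exp ((N : ℝ)⁻¹ • (A + B))‖) atTop (𝓝 0) := by
    have h := hlo.norm_left.tendsto_div_nhds_zero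
    refine h.congr fun N => ?_
    rw [div_inv_eq_mul, mul_comm]
  set K : ℝ := ‖A‖ + ‖B‖ with hK
  have hbound : ∀ᶠ N : ℕ in atTop, ‖(exp ((N : ℝ)⁻¹ • A) * exp ((N : ℝ)⁻¹ • B)) ^ N
      - exp (A + B)‖ ≤ Real.exp K * (N * ‖exp ((N : ℝ)⁻¹ • A) * exp ((N : ℝ)⁻¹ • B)
      - exp ((N : ℝ)⁻¹ • (A + B))‖) := by
    filter_upwards [eventually_gt_atTop 0] with N hN
    have hN' : (N : ℝ) ≠ 0 := by positivity
    have hpow : exp (A + B) = exp ((N : ℝ)⁻¹ • (A + B)) ^ N := by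
      let _ : NormedAlgebra ℚ 𝔸 := .restrictScalars ℚ ℝ 𝔸
      rw [← exp_nsmul, ← Nat.cast_smul_eq_nsmul ℝ, smul_smul, mul_inv_cancel₀ hN', one_smul]
    have hnorm (X : 𝔸) : ‖exp ((N : ℝ)⁻¹ • X)‖ ≤ Real.exp ((N : ℝ)⁻¹ * ‖X‖) := by
      refine (norm_exp_le_exp_norm _).trans_eq ?_
      rw [norm_smul, Real.norm_of_nonneg (by positivity)]
    have h1 : ‖exp ((N : ℝ)⁻¹ • A) * exp ((N : ℝ)⁻¹ • B)‖ ≤ Real.exp ((N : ℝ)⁻¹ * K) := by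
      rw [hK, mul_add, Real.exp_add]
      exact (norm_mul_le _ _).trans
        (mul_le_mul (hnorm A) (hnorm B) (norm_nonneg _) (Real.exp_nonneg _))
    have h2 : ‖exp ((N : ℝ)⁻¹ • (A + B))‖ ≤ Real.exp ((N : ℝ)⁻¹ * K) := by
      refine (hnorm _).trans ?_
      gcongr
      exact norm_add_le _ _
    have hcK : Real.exp ((N : ℝ)⁻¹ * K) ^ N = Real.exp K := by
      rw [← Real.exp_nat_mul]
      congr 1
      field_simp
    have h3 := norm_pow_sub_pow_le h1 h2 (Real.one_le_exp (by positivity)) N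
    rw [hpow]
    rw [hcK] at h3
    linarith
  rw [tendsto_iff_norm_sub_tendsto_zero]
  refine squeeze_zero' (Eventually.of_forall fun _ => norm_nonneg _) hbound ?_
  simpa using hlim.const_mul (Real.exp K)

end Trotter

/-! ### Golden–Thompson inequality for real symmetric matrices. -/

section GoldenThompson

open Matrix Filter Topology

variable {ι : Type*} [Fintype ι]

theorem abs_trace_mul_le (X Y : Matrix ι ι ℝ) :
    |(X * Y).trace| ≤ √(X * Xᵀ).trace * √(Y * Yᵀ).trace := by
  have hsq (Z : Matrix ι ι ℝ) : (Z * Zᵀ).trace = ∑ p : ι × ι, Z p.1 p.2 ^ 2 := by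
    simp [trace, mul_apply, Fintype.sum_prod_type, sq]
  have hsq' : (Y * Yᵀ).trace = ∑ p : ι × ι, Y p.2 p.1 ^ 2 := by
    rw [hsq, ← Equiv.sum_comp (Equiv.prodComm ι ι)]; rfl
  have hXY : (X * Y).trace = ∑ p : ι × ι, X p.1 p.2 * Y p.2 p.1 := by
    simp [trace, mul_apply, Fintype.sum_prod_type]
  rw [hsq X, hsq', hXY, ← Real.sqrt_mul (by positivity)]
  exact Real.abs_le_sqrt (Finset.sum_mul_sq_le_sq_mul_sq _ _ _)

variable [DecidableEq ι]

theorem abs_trace_sq_le (X : Matrix ι ι ℝ) : |(X ^ 2).trace| ≤ (X * Xᵀ).trace := by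
  rw [sq]
  refine (abs_trace_mul_le X X).trans_eq (Real.mul_self_sqrt ?_)
  exact (posSemidef_self_mul_conjTranspose X).trace_nonneg

theorem trace_pow_mul_comm (X Y : Matrix ι ι ℝ) (k : ℕ) :
    ((X * Y) ^ k).trace = ((Y * X) ^ k).trace := by
  rcases k with _ | k
  · simp
  · have h : (X * Y) ^ (k + 1) = X * ((Y * X) ^ k * Y) := by
      rw [pow_succ', mul_assoc, ← mul_assoc, ← mul_assoc]
      rw [mul_assoc X Y, mul_assoc X, ← SemiconjBy.eq (SemiconjBy.pow_right
        (show SemiconjBy Y (X * Y) (Y * X) by simp [SemiconjBy, mul_assoc]) k)]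
    rw [h, trace_mul_comm, mul_assoc, ← pow_succ]

/-- The two families are proved together because each feeds the other. The first at `k + 1` comes
from itself at `X ^ 2`, cyclicity of the trace, the second for `XᵀX` and `XXᵀ`, and Cauchy–Schwarz.
The second at `k + 1` comes from the first at `X = P Q`, then the second for `P ^ 2` and `Q ^ 2`. -/
theorem abs_trace_pow_two_pow_le_aux (k : ℕ) :
    (∀ X : Matrix ι ι ℝ, |(X ^ 2 ^ (k + 1)).trace| ≤ ((X * Xᵀ) ^ 2 ^ k).trace) ∧
    (∀ P Q : Matrix ι ι ℝ, P.IsSymm → Q.IsSymm →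
      |((P * Q) ^ 2 ^ k).trace| ≤ |(P ^ 2 ^ k * Q ^ 2 ^ k).trace|) := by
  induction k with
  | zero => exact ⟨fun X => by simpa using abs_trace_sq_le X, fun P Q _ _ => by simp⟩
  | succ k ih =>
    obtain ⟨ihX, ihPQ⟩ := ih
    have hsymm (X : Matrix ι ι ℝ) : (X * Xᵀ).IsSymm := by simp [IsSymm]
    have hsymm' (X : Matrix ι ι ℝ) : (Xᵀ * X).IsSymm := by simp [IsSymm]
    constructor
    · intro X
      have h1 : |(X ^ 2 ^ (k + 1 + 1)).trace| ≤ ((X ^ 2 * (X ^ 2)ᵀ) ^ 2 ^ k).trace := by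
        rw [pow_succ' 2 (k + 1), pow_mul]
        exact ihX _
      have h2 : ((X ^ 2 * (X ^ 2)ᵀ) ^ 2 ^ k).trace = (((Xᵀ * X) * (X * Xᵀ)) ^ 2 ^ k).trace := by
        rw [sq, transpose_mul, show X * X * (Xᵀ * Xᵀ) = X * (X * Xᵀ * Xᵀ) by
          simp only [mul_assoc], trace_pow_mul_comm,
          show X * Xᵀ * Xᵀ * X = X * Xᵀ * (Xᵀ * X) by simp only [mul_assoc], trace_pow_mul_comm]
      have h3 := ihPQ _ _ (hsymm' X) (hsymm X)
      have h4 := abs_trace_mul_le ((Xᵀ * X) ^ 2 ^ k) ((X * Xᵀ) ^ 2 ^ k)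
      rw [((hsymm' X).pow _).eq, ((hsymm X).pow _).eq, ← pow_add, ← pow_add, ← two_mul,
        ← pow_succ', trace_pow_mul_comm Xᵀ X, Real.mul_self_sqrt] at h4
      · exact h1.trans (h2.le.trans ((le_abs_self _).trans (h3.trans h4)))
      · exact ((posSemidef_self_mul_conjTranspose X).pow _).trace_nonneg
    · intro P Q hP hQ
      have h1 := ihX (P * Q)
      have h2 : ((P * Q * (P * Q)ᵀ) ^ 2 ^ k).trace = ((P ^ 2 * Q ^ 2) ^ 2 ^ k).trace := by
        rw [transpose_mul, hP.eq, hQ.eq, trace_pow_mul_comm, show Q * P * (P * Q) = Q * (P * P * Q)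
          by simp only [mul_assoc], trace_pow_mul_comm]
        simp only [sq, mul_assoc]
      have h3 := ihPQ _ _ (hP.pow 2) (hQ.pow 2)
      rw [← pow_mul, ← pow_mul, ← pow_succ'] at h3
      exact h1.trans (h2.le.trans ((le_abs_self _).trans h3))

/-- The **Golden–Thompson inequality** for real symmetric matrices. -/
theorem trace_exp_add_le [Nonempty ι] {A B : Matrix ι ι ℝ} (hA : A.IsSymm) (hB : B.IsSymm) :
    (NormedSpace.exp (A + B)).trace ≤ |(NormedSpace.exp A * NormedSpace.exp B).trace| := by
  have hpow (k : ℕ) (X : Matrix ι ι ℝ) :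
      NormedSpace.exp (((2 ^ k : ℕ) : ℝ)⁻¹ • X) ^ 2 ^ k = NormedSpace.exp X := by
    rw [← Matrix.exp_nsmul, ← Nat.cast_smul_eq_nsmul ℝ, smul_smul,
      mul_inv_cancel₀ (by positivity), one_smul]
  let _ : NormedRing (Matrix ι ι ℝ) := Matrix.linftyOpNormedRing
  let _ : NormedAlgebra ℝ (Matrix ι ι ℝ) := Matrix.linftyOpNormedAlgebra
  let _ : NormedAlgebra ℚ (Matrix ι ι ℝ) := .restrictScalars ℚ ℝ _
  have : NormOneClass (Matrix ι ι ℝ) := Matrix.linfty_opNormOneClass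
  -- Only exponents `2 ^ k` are covered by the trace inequality, so the limit is taken along that
  -- subsequence.
  have hlim := (tendsto_exp_mul_exp_pow A B).comp
    (tendsto_pow_atTop_atTop_of_one_lt (one_lt_two : 1 < 2))
  have htr := ((continuous_id.matrix_trace (n := ι) (R := ℝ)).tendsto _).comp hlim
  refine le_of_tendsto htr (Eventually.of_forall fun k => ?_)
  simp only [Function.comp_apply, id]
  refine (le_abs_self _).trans ?_
  have h := (abs_trace_pow_two_pow_le_aux k).2 (NormedSpace.exp (((2 ^ k : ℕ) : ℝ)⁻¹ • A))
    (NormedSpace.exp (((2 ^ k : ℕ) : ℝ)⁻¹ • B)) (hA.smul _).exp (hB.smul _).exp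
  rwa [hpow, hpow] at h

end GoldenThompson

/-! ### Loewner order, matrix exponential and the one-step trace bound. -/

section MatrixInequalities

open Matrix
open scoped MatrixOrder

variable {ι : Type*} [Fintype ι]

/-- No lower bound on `x` is required, so its matrix form asks only for `A ≤ 1`. -/
theorem exp_le_one_add_add_sq {x : ℝ} (hx : x ≤ 1) : Real.exp x ≤ 1 + x + x ^ 2 := by
  rcases le_or_gt (-1) x with h | h
  · have h1 := Real.norm_exp_sub_one_sub_id_le (x := x) (by rw [Real.norm_eq_abs, abs_le]; exact ⟨h, hx⟩)
    rw [Real.norm_eq_abs, Real.norm_eq_abs, sq_abs] at h1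
    linarith [le_abs_self (Real.exp x - 1 - x)]
  · have h1 : Real.exp x ≤ 1 := Real.exp_le_one_iff.2 (by linarith)
    nlinarith

theorem dotProduct_mulVec_le_of_le {A B : Matrix ι ι ℝ} (h : A ≤ B) (u : ι → ℝ) :
    u ⬝ᵥ (A *ᵥ u) ≤ u ⬝ᵥ (B *ᵥ u) := by
  have h1 := (Matrix.le_iff.1 h).dotProduct_mulVec_nonneg u
  rw [sub_mulVec, dotProduct_sub, star_trivial] at h1
  linarith

theorem posSemidef_mul_self {A : Matrix ι ι ℝ} (hA : A.IsHermitian) : (A * A).PosSemidef := by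
  have h := posSemidef_conjTranspose_mul_self A
  rwa [hA.eq] at h

theorem smul_le_smul_of_coeff_le {κ : Type*} {A : Matrix κ κ ℝ} (hA : A.PosSemidef) {a b : ℝ} (h : a ≤ b) :
    a • A ≤ b • A := by
  rw [Matrix.le_iff, ← sub_smul]
  exact hA.smul (sub_nonneg.2 h)

theorem smul_le_smul_of_le {κ : Type*} {A B : Matrix κ κ ℝ} (h : A ≤ B) {a : ℝ} (ha : 0 ≤ a) :
    a • A ≤ a • B := by
  rw [Matrix.le_iff, ← smul_sub]
  exact (Matrix.le_iff.1 h).smul ha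

variable [DecidableEq ι]

/-- The spectral theorem in the form `A = V D Vᵀ`, jointly with `exp A = V exp(D) Vᵀ`. -/
theorem exists_diagonalization {A : Matrix ι ι ℝ} (hA : A.IsHermitian) :
    ∃ V : Matrix ι ι ℝ, Vᴴ * V = 1 ∧ V * Vᴴ = 1 ∧ A = V * diagonal hA.eigenvalues * Vᴴ ∧
      NormedSpace.exp A = V * diagonal (fun i => Real.exp (hA.eigenvalues i)) * Vᴴ := by
  let V : Matrix ι ι ℝ := (hA.eigenvectorUnitary : Matrix ι ι ℝ)
  have h1 : Vᴴ * V = 1 := (Matrix.mem_unitaryGroup_iff'.1 hA.eigenvectorUnitary.2)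
  have h2 : V * Vᴴ = 1 := (Matrix.mem_unitaryGroup_iff.1 hA.eigenvectorUnitary.2)
  have h3 : A = V * diagonal hA.eigenvalues * Vᴴ := by
    have h := hA.spectral_theorem
    rw [Unitary.conjStarAlgAut_apply] at h
    exact h
  have hinv : V⁻¹ = Vᴴ := Matrix.inv_eq_left_inv h1
  refine ⟨V, h1, h2, h3, ?_⟩
  conv_lhs => rw [h3]
  rw [← hinv, Matrix.exp_conj V _ (IsUnit.of_mul_eq_one _ h2), Matrix.exp_diagonal]
  congr 3
  ext i
  rw [Pi.exp_def, Real.exp_eq_exp_ℝ]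

theorem conj_diagonal_le_conj_diagonal (V : Matrix ι ι ℝ) {a b : ι → ℝ} (h : ∀ i, a i ≤ b i) :
    V * diagonal a * Vᴴ ≤ V * diagonal b * Vᴴ := by
  rw [Matrix.le_iff, ← Matrix.sub_mul, ← Matrix.mul_sub, diagonal_sub]
  exact (posSemidef_diagonal_iff.2 fun i => sub_nonneg.2 (h i)).mul_mul_conjTranspose_same V

theorem posSemidef_exp {A : Matrix ι ι ℝ} (hA : A.IsHermitian) :
    (NormedSpace.exp A).PosSemidef := by
  obtain ⟨V, -, -, -, h⟩ := exists_diagonalization hA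
  rw [h]
  exact (posSemidef_diagonal_iff.2 fun i => (Real.exp_nonneg _)).mul_mul_conjTranspose_same V

theorem eigenvalues_le_of_le_smul_one {A : Matrix ι ι ℝ} (hA : A.IsHermitian) {m : ℝ}
    (h : A ≤ m • (1 : Matrix ι ι ℝ)) (i : ι) : hA.eigenvalues i ≤ m := by
  have h1 := dotProduct_mulVec_le_of_le h (hA.eigenvectorBasis i)
  rw [hA.mulVec_eigenvectorBasis, smul_mulVec, one_mulVec, dotProduct_smul, dotProduct_smul,
    smul_eq_mul, smul_eq_mul] at h1
  have h2 : 0 < (hA.eigenvectorBasis i : ι → ℝ) ⬝ᵥ (hA.eigenvectorBasis i : ι → ℝ) := by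
    have h3 : (0 : ℝ) < star (hA.eigenvectorBasis i : ι → ℝ) ⬝ᵥ (hA.eigenvectorBasis i : ι → ℝ) := by
      rw [dotProduct_star_self_pos_iff]
      simpa using hA.eigenvectorBasis.toBasis.ne_zero i
    rwa [star_trivial] at h3
  exact le_of_mul_le_mul_right h1 h2

theorem exp_le_one_add_add_mul_self {A : Matrix ι ι ℝ} (hA : A.IsHermitian) (h : A ≤ 1) :
    NormedSpace.exp A ≤ 1 + A + A * A := by
  obtain ⟨V, h1, h2, h3, h4⟩ := exists_diagonalization hA
  have hev := eigenvalues_le_of_le_smul_one hA (m := 1) (by rwa [one_smul])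
  have hsq : A * A = V * diagonal (fun i => hA.eigenvalues i ^ 2) * Vᴴ := by
    conv_lhs => rw [h3]
    rw [show V * diagonal hA.eigenvalues * Vᴴ * (V * diagonal hA.eigenvalues * Vᴴ)
      = V * diagonal hA.eigenvalues * (Vᴴ * V) * diagonal hA.eigenvalues * Vᴴ by
        simp only [mul_assoc], h1, mul_one, mul_assoc V, diagonal_mul_diagonal]
    simp only [sq]
  have hone : (1 : Matrix ι ι ℝ) = V * diagonal (fun _ => 1) * Vᴴ := by
    rw [diagonal_one, mul_one, h2]
  have hsum : 1 + A + A * A = V * diagonal (fun i => 1 + hA.eigenvalues i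
      + hA.eigenvalues i ^ 2) * Vᴴ := by
    rw [hsq]
    rw [← diagonal_add, ← diagonal_add, Matrix.mul_add, Matrix.mul_add, Matrix.add_mul,
      Matrix.add_mul, ← hone, ← h3]
  rw [hsum, h4]
  exact conj_diagonal_le_conj_diagonal V fun i => exp_le_one_add_add_sq (hev i)

theorem trace_exp_eq_sum {A : Matrix ι ι ℝ} (hA : A.IsHermitian) :
    (NormedSpace.exp A).trace = ∑ i, Real.exp (hA.eigenvalues i) := by
  obtain ⟨V, h1, -, -, h⟩ := exists_diagonalization hA
  rw [h, trace_mul_comm, ← mul_assoc, h1, one_mul, trace_diagonal]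

theorem trace_exp_le_card_mul_exp {A : Matrix ι ι ℝ} (hA : A.IsHermitian) {m : ℝ}
    (h : A ≤ m • (1 : Matrix ι ι ℝ)) :
    (NormedSpace.exp A).trace ≤ Fintype.card ι * Real.exp m := by
  rw [trace_exp_eq_sum hA]
  refine (Finset.sum_le_card_nsmul _ _ (Real.exp m) fun i _ =>
    Real.exp_le_exp.2 (eigenvalues_le_of_le_smul_one hA h i)).trans_eq ?_
  rw [nsmul_eq_mul, Finset.card_univ]

/-- The test vector forces some eigenvalue to be at least `t`, since otherwise `t - A` would be
positive definite; the other terms of the trace are nonnegative. This is the lower bound used in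
Markov's inequality. -/
theorem exp_le_trace_exp {A : Matrix ι ι ℝ} (hA : A.IsHermitian) {t : ℝ} {u : ι → ℝ} (hu : u ≠ 0)
    (h : t * (u ⬝ᵥ u) ≤ u ⬝ᵥ (A *ᵥ u)) : Real.exp t ≤ (NormedSpace.exp A).trace := by
  rw [trace_exp_eq_sum hA]
  obtain ⟨i, hi⟩ : ∃ i, t ≤ hA.eigenvalues i := by
    by_contra! hcon
    obtain ⟨V, h1, h2, h3, -⟩ := exists_diagonalization hA
    have hone : t • (1 : Matrix ι ι ℝ) - A = V * diagonal (fun i => t - hA.eigenvalues i) * Vᴴ := by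
      rw [← diagonal_sub, Matrix.mul_sub, Matrix.sub_mul, ← h3]
      congr 1
      rw [show (fun _ => t : ι → ℝ) = t • fun _ => 1 by ext; simp, diagonal_smul, diagonal_one]
      rw [Matrix.mul_smul, Matrix.smul_mul, mul_one, h2]
    have hpd : (t • (1 : Matrix ι ι ℝ) - A).PosDef := by
      rw [hone]
      refine (posDef_diagonal_iff.2 fun i => sub_pos.2 (hcon i)).mul_mul_conjTranspose_same ?_
      exact Matrix.vecMul_injective_of_isUnit (IsUnit.of_mul_eq_one _ h2)
    have h4 := hpd.dotProduct_mulVec_pos hu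
    rw [star_trivial, sub_mulVec, dotProduct_sub, smul_mulVec, one_mulVec, dotProduct_smul,
      smul_eq_mul] at h4
    linarith
  exact (Real.exp_le_exp.2 hi).trans
    (Finset.single_le_sum (f := fun i => Real.exp (hA.eigenvalues i))
      (fun _ _ => Real.exp_nonneg _) (Finset.mem_univ i))

theorem trace_mul_nonneg {P Q : Matrix ι ι ℝ} (hP : P.PosSemidef) (hQ : Q.PosSemidef) :
    0 ≤ (P * Q).trace := by
  obtain ⟨B, rfl⟩ := CStarAlgebra.nonneg_iff_eq_star_mul_self.1 hP.nonneg
  rw [star_eq_conjTranspose, mul_assoc, trace_mul_comm]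
  exact (hQ.mul_mul_conjTranspose_same B).trace_nonneg

/-- With `S` the square root of `A`, the difference `R A - A²` is the congruence `S (R - A) S`. -/
theorem mul_self_le_smul {A : Matrix ι ι ℝ} {R : ℝ} (h0 : A.PosSemidef)
    (hR : (R • (1 : Matrix ι ι ℝ) - A).PosSemidef) : A * A ≤ R • A := by
  set S := CFC.sqrt A with hS
  have hSS : S * S = A := CFC.sqrt_mul_sqrt_self A h0.nonneg
  have hSh : Sᴴ = S := (Matrix.nonneg_iff_posSemidef.1 (CFC.sqrt_nonneg A)).isHermitian
  rw [Matrix.le_iff]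
  have h := hR.conjTranspose_mul_mul_same S
  rw [hSh, ← hSS] at h
  rw [← hSS]
  have heq : R • (S * S) - S * S * (S * S) = S * (R • 1 - S * S) * S := by
    rw [Matrix.mul_sub, Matrix.sub_mul, Matrix.mul_smul, Matrix.smul_mul, mul_one]
    simp only [mul_assoc]
  rwa [heq]

/-- The Cauchy–Schwarz inequality for a combination of symmetric matrices. -/
theorem sum_smul_mul_self_le {κ : Type*} (s : Finset κ) (l : κ → ℝ) {Y : κ → Matrix ι ι ℝ}
    (hY : ∀ j, (Y j).IsHermitian) :
    (∑ j ∈ s, l j • Y j) * (∑ j ∈ s, l j • Y j)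
      ≤ (∑ j ∈ s, |l j|) • ∑ j ∈ s, |l j| • (Y j * Y j) := by
  set c := ∑ j ∈ s, |l j| with hc
  set L := ∑ j ∈ s, l j • Y j with hL
  have hc0 : 0 ≤ c := Finset.sum_nonneg fun _ _ => abs_nonneg _
  have hLh : L.IsHermitian := by
    rw [hL, IsHermitian, conjTranspose_sum]
    exact Finset.sum_congr rfl fun j _ => by rw [conjTranspose_smul, (hY j).eq, star_trivial]
  rcases hc0.eq_or_lt with h0 | h0
  · have hl : ∀ j ∈ s, l j = 0 := fun j hj => abs_eq_zero.1
      ((Finset.sum_eq_zero_iff_of_nonneg fun _ _ => abs_nonneg _).1 h0.symm j hj)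
    have : L = 0 := Finset.sum_eq_zero fun j hj => by rw [hl j hj, zero_smul]
    rw [this, ← h0]
    simp
  · have key : (∑ j ∈ s, |l j| • (((c * SignType.sign (l j)) • Y j - L)
        * ((c * SignType.sign (l j)) • Y j - L))) =
        c • (c • ∑ j ∈ s, |l j| • (Y j * Y j) - L * L) := by
      have hterm (j : κ) : |l j| • (((c * SignType.sign (l j)) • Y j - L)
          * ((c * SignType.sign (l j)) • Y j - L))
          = (c * c) • (|l j| • (Y j * Y j)) - c • (l j • Y j * L) - c • (L * l j • Y j)
            + |l j| • (L * L) := by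
        have h1 : |l j| * (SignType.sign (l j) : ℝ) = l j := by
          rw [mul_comm]; exact sign_mul_abs _
        have h2 : |l j| * (SignType.sign (l j) : ℝ) * (SignType.sign (l j) : ℝ) = |l j| := by
          rw [h1, mul_comm]; exact sign_mul_self _
        simp only [Matrix.mul_sub, Matrix.sub_mul, Matrix.mul_smul, Matrix.smul_mul]
        match_scalars
        · linear_combination c * c * h2
        · linear_combination -c * h1
        · linear_combination -c * h1
        · ring
      simp only [hterm, Finset.sum_add_distrib, Finset.sum_sub_distrib, ← Finset.smul_sum,
        ← Finset.sum_mul, ← Finset.mul_sum, ← Finset.sum_smul, ← hL, ← hc, smul_sub]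
      rw [smul_smul]
      abel
    have hpsd : (∑ j ∈ s, |l j| • (((c * SignType.sign (l j)) • Y j - L)
        * ((c * SignType.sign (l j)) • Y j - L))).PosSemidef := by
      refine posSemidef_sum _ fun j _ => ?_
      refine (posSemidef_mul_self ?_).smul (abs_nonneg _)
      refine IsHermitian.sub ?_ hLh
      rw [IsHermitian, conjTranspose_smul, (hY j).eq, star_trivial]
    rw [key] at hpsd
    have h := hpsd.smul (inv_nonneg.2 hc0)
    rw [smul_smul, inv_mul_cancel₀ h0.ne', one_smul] at h
    exact h

/-- One step of the exponential supermartingale: averaging over perturbations whose second order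
expansion has a nonpositive mean does not increase the trace exponential. -/
theorem sum_mul_trace_exp_add_le [Nonempty ι] {κ : Type*} (s : Finset κ) {w : κ → ℝ}
    (hw : ∀ k ∈ s, 0 ≤ w k) {A : Matrix ι ι ℝ} (hA : A.IsHermitian) {B : κ → Matrix ι ι ℝ}
    (hB : ∀ k ∈ s, (B k).IsHermitian) (hB1 : ∀ k ∈ s, B k ≤ 1)
    (hsum : ∑ k ∈ s, w k • (B k + B k * B k) ≤ 0) :
    ∑ k ∈ s, w k * (NormedSpace.exp (A + B k)).trace
      ≤ (∑ k ∈ s, w k) * (NormedSpace.exp A).trace := by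
  have hE := posSemidef_exp hA
  have hmono {P Q : Matrix ι ι ℝ} (h : P ≤ Q) :
      (NormedSpace.exp A * P).trace ≤ (NormedSpace.exp A * Q).trace := by
    have h1 := trace_mul_nonneg hE (Matrix.le_iff.1 h)
    rw [Matrix.mul_sub, trace_sub] at h1
    linarith
  have h1 : ∀ k ∈ s, w k * (NormedSpace.exp (A + B k)).trace
      ≤ w k * (NormedSpace.exp A * (1 + B k + B k * B k)).trace := fun k hk => by
    refine mul_le_mul_of_nonneg_left ?_ (hw k hk)
    refine (trace_exp_add_le (isHermitian_iff_isSymm.1 hA)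
      (isHermitian_iff_isSymm.1 (hB k hk))).trans ?_
    -- Both exponentials are positive semidefinite, so the absolute value left by Golden–Thompson
    -- disappears.
    rw [abs_of_nonneg (trace_mul_nonneg hE (posSemidef_exp (hB k hk)))]
    exact hmono (exp_le_one_add_add_mul_self (hB k hk) (hB1 k hk))
  refine (Finset.sum_le_sum h1).trans ?_
  have h2 : ∑ k ∈ s, w k * (NormedSpace.exp A * (1 + B k + B k * B k)).trace
      = (NormedSpace.exp A * ((∑ k ∈ s, w k) • (1 : Matrix ι ι ℝ)
        + ∑ k ∈ s, w k • (B k + B k * B k))).trace := by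
    rw [Finset.sum_smul, ← Finset.sum_add_distrib, Finset.mul_sum, trace_sum]
    refine Finset.sum_congr rfl fun k _ => ?_
    rw [← smul_add, ← add_assoc, Matrix.mul_smul, trace_smul, smul_eq_mul]
  rw [h2]
  refine (hmono (add_le_add_right hsum _)).trans_eq ?_
  rw [add_zero, Matrix.mul_smul, mul_one, trace_smul, smul_eq_mul]

end MatrixInequalities

/-! ### Revealing one random coordinate. -/

section RevealStep

open Matrix
open scoped MatrixOrder

variable {ι V : Type*} [Fintype ι] [DecidableEq ι] [Fintype V] [DecidableEq V]

/-- The influence direction of the coordinate `i`: the combination of the matrices `Y j` by which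
the exponent moves per unit change of the coordinate `i`. -/
def influenceSum (Y : V → Matrix ι ι ℝ) (N : Finset V) (p : V → ℝ) (c : V → V → ℝ) (θ α : ℝ)
    (i : V) : Matrix ι ι ℝ :=
  ∑ j, ((θ + if j ∈ N.erase i then α else 0) * (c i j / (p i * (1 - p i)))) • Y j

/-- The change of the exponent when the coordinate `i` is revealed with deviation `s`. -/
def increment (Y : V → Matrix ι ι ℝ) (N : Finset V) (p : V → ℝ) (c : V → V → ℝ) (θ α : ℝ)
    (i : V) (s : ℝ) : Matrix ι ι ℝ :=
  s • influenceSum Y N p c θ α i - (α * p i) • Y i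

theorem isHermitian_sum_smul (Y : V → Matrix ι ι ℝ) (hY : ∀ j, (Y j).IsHermitian) (l : V → ℝ) :
    (∑ j, l j • Y j).IsHermitian := by
  rw [IsHermitian, conjTranspose_sum]
  exact Finset.sum_congr rfl fun j _ => by rw [conjTranspose_smul, (hY j).eq, star_trivial]

variable {Y : V → Matrix ι ι ℝ} {N : Finset V} {p : V → ℝ} {c : V → V → ℝ} {θ α D R : ℝ}

theorem isHermitian_increment (hY : ∀ j, (Y j).IsHermitian) (i : V) (s : ℝ) :
    (increment Y N p c θ α i s).IsHermitian := by
  have h1 := isHermitian_sum_smul Y hY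
    fun j => (θ + if j ∈ N.erase i then α else 0) * (c i j / (p i * (1 - p i)))
  refine IsHermitian.sub ?_ ?_
  · rw [IsHermitian, conjTranspose_smul, influenceSum, h1.eq, star_trivial]
  · rw [IsHermitian, conjTranspose_smul, (hY i).eq, star_trivial]

theorem sum_abs_div_le (hp0 : ∀ i, 0 ≤ p i) (hp1 : ∀ i, p i ≤ 1)
    (hc : ∀ i, ∑ j, |c i j| ≤ D * (p i * (1 - p i))) (hD : 0 ≤ D) (i : V) :
    ∑ j, |c i j / (p i * (1 - p i))| ≤ D := by
  have hq : 0 ≤ p i * (1 - p i) := mul_nonneg (hp0 i) (sub_nonneg.2 (hp1 i))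
  simp_rw [abs_div, abs_of_nonneg hq, ← Finset.sum_div]
  exact div_le_of_le_mul₀ hq hD (hc i)

theorem abs_coeff_le (hα : 0 ≤ α) (i j : V) (g : ℝ) :
    |(θ + if j ∈ N.erase i then α else 0) * g| ≤ (|θ| + α) * |g| := by
  rw [abs_mul]
  gcongr
  refine (abs_add_le _ _).trans ?_
  gcongr
  split_ifs
  · exact (abs_of_nonneg hα).le
  · simpa using hα

/-- The compensator term is negative and is dropped; the rest is controlled by `Y j ≤ R` and the
absolute row sum `D` of the influences. -/
theorem increment_le_one (hY : ∀ j, (Y j).PosSemidef)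
    (hYR : ∀ j, (R • (1 : Matrix ι ι ℝ) - Y j).PosSemidef) (hR : 0 ≤ R)
    (hp0 : ∀ i, 0 ≤ p i) (hp1 : ∀ i, p i ≤ 1)
    (hc : ∀ i, ∑ j, |c i j| ≤ D * (p i * (1 - p i))) (hD : 0 ≤ D) (hα : 0 ≤ α)
    (hsmall : (|θ| + α) * D * R ≤ 1) (i : V) {s : ℝ} (hs : |s| ≤ 1) :
    increment Y N p c θ α i s ≤ 1 := by
  have h1 : ∀ j, s • ((θ + if j ∈ N.erase i then α else 0) * (c i j / (p i * (1 - p i)))) • Y j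
      ≤ ((|θ| + α) * R * |c i j / (p i * (1 - p i))|) • (1 : Matrix ι ι ℝ) := fun j => by
    rw [smul_smul]
    calc _ ≤ ((|θ| + α) * |c i j / (p i * (1 - p i))|) • Y j := by
          refine smul_le_smul_of_coeff_le (hY j) ((le_abs_self _).trans ?_)
          rw [abs_mul]
          exact (mul_le_of_le_one_left (abs_nonneg _) hs).trans (abs_coeff_le hα i j _)
      _ ≤ ((|θ| + α) * |c i j / (p i * (1 - p i))|) • (R • (1 : Matrix ι ι ℝ)) :=
          smul_le_smul_of_le (Matrix.le_iff.2 (hYR j)) (by positivity)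
      _ = _ := by rw [smul_smul]; congr 1; ring
  have h2 : s • influenceSum Y N p c θ α i ≤ (1 : Matrix ι ι ℝ) := by
    rw [influenceSum, Finset.smul_sum]
    refine (Finset.sum_le_sum fun j _ => h1 j).trans ?_
    rw [← Finset.sum_smul, ← Finset.mul_sum]
    conv_rhs => rw [← one_smul ℝ (1 : Matrix ι ι ℝ)]
    refine smul_le_smul_of_coeff_le PosSemidef.one ?_
    refine le_trans ?_ hsmall
    rw [mul_right_comm]
    exact mul_le_mul_of_nonneg_right (mul_le_mul_of_nonneg_left
      (sum_abs_div_le hp0 hp1 hc hD i) (by positivity)) hR |>.trans' (le_of_eq (by ring))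
  rw [increment]
  have h3 : (0 : Matrix ι ι ℝ) ≤ (α * p i) • Y i :=
    ((hY i).smul (mul_nonneg hα (hp0 i))).nonneg
  exact (sub_le_self _ h3).trans h2

theorem smul_influenceSum_mul_self_le (hY : ∀ j, (Y j).PosSemidef)
    (hYR : ∀ j, (R • (1 : Matrix ι ι ℝ) - Y j).PosSemidef)
    (hp0 : ∀ i, 0 ≤ p i) (hp1 : ∀ i, p i ≤ 1)
    (hc : ∀ i, ∑ j, |c i j| ≤ D * (p i * (1 - p i))) (hD : 0 ≤ D) (hR : 0 ≤ R) (hα : 0 ≤ α) (i : V) :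
    (p i * (1 - p i)) • (influenceSum Y N p c θ α i * influenceSum Y N p c θ α i)
      ≤ ((|θ| + α) ^ 2 * D * R) • ∑ j, |c i j| • Y j := by
  have hq : 0 ≤ p i * (1 - p i) := mul_nonneg (hp0 i) (sub_nonneg.2 (hp1 i))
  set g : V → ℝ := fun j => c i j / (p i * (1 - p i)) with hg
  -- If the variance vanishes, the covariance bound kills the whole row of `c`, so the identity
  -- survives division by zero.
  have hqg : ∀ j, p i * (1 - p i) * |g j| = |c i j| := fun j => by
    rcases hq.eq_or_lt with h | h
    · have h0 : ∑ j, |c i j| ≤ 0 := by simpa [← h] using hc i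
      have := (Finset.single_le_sum (f := fun j => |c i j|) (fun _ _ => abs_nonneg _)
        (Finset.mem_univ j)).trans h0
      rw [← h, zero_mul]
      exact (le_antisymm this (abs_nonneg _)).symm
    · rw [hg]
      simp only [abs_div, abs_of_pos h]
      exact mul_div_cancel₀ _ h.ne'
  have h1 := sum_smul_mul_self_le Finset.univ
    (fun j => (θ + if j ∈ N.erase i then α else 0) * g j) fun j => (hY j).isHermitian
  have h2 : (∑ j, |(θ + if j ∈ N.erase i then α else 0) * g j| • (Y j * Y j))
      ≤ ∑ j, ((|θ| + α) * |g j| * R) • Y j := Finset.sum_le_sum fun j _ => by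
    calc _ ≤ |(θ + if j ∈ N.erase i then α else 0) * g j| • (R • Y j) :=
          smul_le_smul_of_le (mul_self_le_smul (hY j) (hYR j)) (abs_nonneg _)
      _ ≤ ((|θ| + α) * |g j|) • (R • Y j) :=
          smul_le_smul_of_coeff_le ((hY j).smul hR) (abs_coeff_le hα i j _)
      _ = _ := by rw [smul_smul]
  have h3 : ∑ j, |(θ + if j ∈ N.erase i then α else 0) * g j| ≤ (|θ| + α) * D := by
    refine (Finset.sum_le_sum fun j _ => abs_coeff_le hα i j (g j)).trans ?_
    rw [← Finset.mul_sum]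
    exact mul_le_mul_of_nonneg_left (sum_abs_div_le hp0 hp1 hc hD i) (by positivity)
  have h4 : (∑ j, ((|θ| + α) * |g j| * R) • Y j).PosSemidef :=
    posSemidef_sum _ fun j _ => (hY j).smul (by positivity)
  calc _ ≤ (p i * (1 - p i)) • (((|θ| + α) * D) • ∑ j, ((|θ| + α) * |g j| * R) • Y j) :=
        smul_le_smul_of_le (h1.trans ((smul_le_smul_of_le h2
          (Finset.sum_nonneg fun _ _ => abs_nonneg _)).trans (smul_le_smul_of_coeff_le h4 h3))) hq
    _ = _ := by
        simp only [Finset.smul_sum, smul_smul]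
        refine Finset.sum_congr rfl fun j _ => ?_
        rw [← hqg j]
        congr 1
        ring

/-- The deviation has mean zero and variance `p i * (1 - p i)`, so the terms linear in it, including
the cross terms of the square, cancel. -/
theorem sum_increment_add_mul_self (i : V) :
    p i • (increment Y N p c θ α i (1 - p i)
        + increment Y N p c θ α i (1 - p i) * increment Y N p c θ α i (1 - p i))
      + (1 - p i) • (increment Y N p c θ α i (-p i)
        + increment Y N p c θ α i (-p i) * increment Y N p c θ α i (-p i))
      = (p i * (1 - p i)) • (influenceSum Y N p c θ α i * influenceSum Y N p c θ α i)
        + (α ^ 2 * p i ^ 2) • (Y i * Y i) - (α * p i) • Y i := by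
  simp only [increment]
  generalize influenceSum Y N p c θ α i = L
  simp only [Matrix.mul_sub, Matrix.sub_mul, Matrix.mul_smul, Matrix.smul_mul]
  match_scalars <;> ring

/-- The mean of the second order expansion of the increments is nonpositive. -/
theorem sum_sum_increment_nonpos (hY : ∀ j, (Y j).PosSemidef)
    (hYR : ∀ j, (R • (1 : Matrix ι ι ℝ) - Y j).PosSemidef)
    (hp0 : ∀ i, 0 ≤ p i) (hp1 : ∀ i, p i ≤ 1) (hcs : ∀ i j, c i j = c j i)
    (hc : ∀ i, ∑ j, |c i j| ≤ D * (p i * (1 - p i))) (hN : ∀ j ∉ N, p j * (1 - p j) = 0)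
    (hD : 0 ≤ D) (hR : 0 ≤ R) (hα : 0 ≤ α) (hbal : (|θ| + α) ^ 2 * D ^ 2 * R + α ^ 2 * R ≤ α) :
    ∑ i ∈ N, ((p i * (1 - p i)) • (influenceSum Y N p c θ α i * influenceSum Y N p c θ α i)
        + (α ^ 2 * p i ^ 2) • (Y i * Y i) - (α * p i) • Y i) ≤ 0 := by
  have h1 : ∑ i ∈ N, ((|θ| + α) ^ 2 * D * R) • ∑ j, |c i j| • Y j
      ≤ ∑ j ∈ N, ((|θ| + α) ^ 2 * D ^ 2 * R * p j) • Y j := by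
    -- Symmetry of the covariance turns the row bound into a column bound.
    have h2 : ∀ j, ∑ i ∈ N, |c i j| ≤ D * (p j * (1 - p j)) := fun j => by
      refine le_trans ?_ (hc j)
      simp_rw [hcs j]
      exact Finset.sum_le_sum_of_subset_of_nonneg (Finset.subset_univ _) fun _ _ _ => abs_nonneg _
    -- Revealed coordinates have zero variance, so a compensator supported on `N` suffices.
    have h3 : ∑ j, ((|θ| + α) ^ 2 * D * R * (D * (p j * (1 - p j)))) • Y j
        = ∑ j ∈ N, ((|θ| + α) ^ 2 * D * R * (D * (p j * (1 - p j)))) • Y j :=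
      (Finset.sum_subset (Finset.subset_univ N) fun j _ hj => by simp [hN j hj]).symm
    calc _ = ∑ j, ((|θ| + α) ^ 2 * D * R * ∑ i ∈ N, |c i j|) • Y j := by
          simp only [Finset.smul_sum, Finset.mul_sum, Finset.sum_smul, smul_smul]
          exact Finset.sum_comm
      _ ≤ ∑ j, ((|θ| + α) ^ 2 * D * R * (D * (p j * (1 - p j)))) • Y j :=
          Finset.sum_le_sum fun j _ => smul_le_smul_of_coeff_le (hY j)
            (mul_le_mul_of_nonneg_left (h2 j) (by positivity))
      _ ≤ _ := by
          rw [h3]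
          refine Finset.sum_le_sum fun j _ => smul_le_smul_of_coeff_le (hY j) ?_
          have h4 : p j * (1 - p j) ≤ p j := by nlinarith [hp0 j]
          calc _ = (|θ| + α) ^ 2 * D ^ 2 * R * (p j * (1 - p j)) := by ring
            _ ≤ _ := mul_le_mul_of_nonneg_left h4 (by positivity)
  have h5 : ∀ i, (α ^ 2 * p i ^ 2) • (Y i * Y i) ≤ (α ^ 2 * R * p i) • Y i := fun i => by
    calc _ ≤ (α ^ 2 * p i ^ 2) • (R • Y i) :=
          smul_le_smul_of_le (mul_self_le_smul (hY i) (hYR i)) (by positivity)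
      _ = (α ^ 2 * R * p i ^ 2) • Y i := by rw [smul_smul]; congr 1; ring
      _ ≤ _ := smul_le_smul_of_coeff_le (hY i) (mul_le_mul_of_nonneg_left
          (by nlinarith [hp0 i, hp1 i]) (by positivity))
  rw [Finset.sum_sub_distrib, Finset.sum_add_distrib, sub_nonpos]
  calc _ ≤ ∑ j ∈ N, ((|θ| + α) ^ 2 * D ^ 2 * R * p j) • Y j + ∑ i ∈ N, (α ^ 2 * R * p i) • Y i :=
        add_le_add ((Finset.sum_le_sum fun i _ =>
          smul_influenceSum_mul_self_le hY hYR hp0 hp1 hc hD hR hα i).trans h1)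
          (Finset.sum_le_sum fun i _ => h5 i)
    _ ≤ _ := by
        rw [← Finset.sum_add_distrib]
        refine Finset.sum_le_sum fun i _ => ?_
        rw [← add_smul, ← add_mul]
        exact smul_le_smul_of_coeff_le (hY i) (mul_le_mul_of_nonneg_right hbal (hp0 i))

/-- Revealing a uniformly random coordinate of `N` does not increase the trace exponential. -/
theorem sum_trace_exp_increment_le [Nonempty ι] (hY : ∀ j, (Y j).PosSemidef)
    (hYR : ∀ j, (R • (1 : Matrix ι ι ℝ) - Y j).PosSemidef)
    (hp0 : ∀ i, 0 ≤ p i) (hp1 : ∀ i, p i ≤ 1) (hcs : ∀ i j, c i j = c j i)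
    (hc : ∀ i, ∑ j, |c i j| ≤ D * (p i * (1 - p i))) (hN : ∀ j ∉ N, p j * (1 - p j) = 0)
    (hD : 0 ≤ D) (hR : 0 ≤ R) (hα : 0 ≤ α) (hbal : (|θ| + α) ^ 2 * D ^ 2 * R + α ^ 2 * R ≤ α)
    (hsmall : (|θ| + α) * D * R ≤ 1) {A : Matrix ι ι ℝ} (hA : A.IsHermitian) :
    ∑ i ∈ N, (p i * (NormedSpace.exp (A + increment Y N p c θ α i (1 - p i))).trace
        + (1 - p i) * (NormedSpace.exp (A + increment Y N p c θ α i (-p i))).trace)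
      ≤ N.card * (NormedSpace.exp A).trace := by
  -- The perturbations are indexed by a coordinate and its revealed value; the weights add up to
  -- `N.card`.
  have h := sum_mul_trace_exp_add_le (N ×ˢ (Finset.univ : Finset Bool))
    (w := fun k => bif k.2 then p k.1 else 1 - p k.1) (A := A)
    (B := fun k => increment Y N p c θ α k.1 (bif k.2 then 1 - p k.1 else -p k.1))
    (by rintro ⟨i, _ | _⟩ _ <;> simp [hp0, hp1]) hA
    (fun k _ => isHermitian_increment (fun j => (hY j).isHermitian) _ _)
    (fun k _ => by
      refine increment_le_one hY hYR hR hp0 hp1 hc hD hα hsmall _ ?_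
      obtain ⟨i, b⟩ := k
      cases b
      · simpa [abs_of_nonneg (hp0 i)] using hp1 i
      · simpa [abs_of_nonneg (sub_nonneg.2 (hp1 i))] using hp0 i)
    (by
      rw [Finset.sum_product]
      simp only [Fintype.sum_bool, cond_true, cond_false, sum_increment_add_mul_self]
      exact sum_sum_increment_nonpos hY hYR hp0 hp1 hcs hc hN hD hR hα hbal)
  simpa [Finset.sum_product] using h

end RevealStep

/-! ### Conditioning weights on the cube and the supermartingale induction. -/

section Weights

open Matrix

variable {V : Type*} [Fintype V] [DecidableEq V]

/-- The numerical value of a coordinate. -/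
def bit (x : V → Bool) (i : V) : ℝ := if x i = true then 1 else 0

/-- The total mass of a weight function on the cube. -/
def mass (v : (V → Bool) → ℝ) : ℝ := ∑ x, v x

/-- The mean of a coordinate under the normalized weight. -/
def mean (v : (V → Bool) → ℝ) (i : V) : ℝ := (∑ x, v x * bit x i) / mass v

/-- The covariance of two coordinates under the normalized weight. -/
def covar (v : (V → Bool) → ℝ) (i j : V) : ℝ :=
  (∑ x, v x * (bit x i * bit x j)) / mass v - mean v i * mean v j

/-- The restriction of a weight to the outcomes that agree with `y` on `Λ`. -/
def restrictTo (w : (V → Bool) → ℝ) (Λ : Finset V) (y : V → Bool) (x : V → Bool) : ℝ :=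
  if ∀ l ∈ Λ, x l = y l then w x else 0

/-- The restriction of a weight to the outcomes with a given value of a coordinate. -/
def branch (v : (V → Bool) → ℝ) (i : V) (b : Bool) (x : V → Bool) : ℝ := if x i = b then v x else 0

variable {v w : (V → Bool) → ℝ}

theorem bit_nonneg (x : V → Bool) (i : V) : 0 ≤ bit x i := by
  unfold bit; split_ifs <;> norm_num

theorem bit_le_one (x : V → Bool) (i : V) : bit x i ≤ 1 := by
  unfold bit; split_ifs <;> norm_num

theorem branch_restrictTo {Λ : Finset V} {y : V → Bool} {i : V} (hi : i ∉ Λ) (b : Bool) :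
    branch (restrictTo w Λ y) i b = restrictTo w (insert i Λ) (Function.update y i b) := by
  ext x
  unfold branch restrictTo
  have h : (∀ l ∈ insert i Λ, x l = Function.update y i b l) ↔ x i = b ∧ ∀ l ∈ Λ, x l = y l := by
    rw [Finset.forall_mem_insert, Function.update_self]
    refine and_congr_right fun _ => forall₂_congr fun l hl => ?_
    rw [Function.update_of_ne (ne_of_mem_of_not_mem hl hi)]
  simp only [h]
  split_ifs <;> tauto

theorem branch_true (v : (V → Bool) → ℝ) (i : V) (x : V → Bool) :
    branch v i true x = v x * bit x i := by
  unfold branch bit; split_ifs <;> simp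

theorem branch_false (v : (V → Bool) → ℝ) (i : V) (x : V → Bool) :
    branch v i false x = v x * (1 - bit x i) := by
  unfold branch bit; cases x i <;> simp

theorem sum_branch_add (v : (V → Bool) → ℝ) (i : V) (f : (V → Bool) → ℝ) :
    ∑ x, branch v i true x * f x + ∑ x, branch v i false x * f x = ∑ x, v x * f x := by
  rw [← Finset.sum_add_distrib]
  refine Finset.sum_congr rfl fun x _ => ?_
  rw [branch_true, branch_false]
  ring

theorem restrictTo_nonneg (hw : ∀ x, 0 ≤ w x) (Λ : Finset V) (y x : V → Bool) :
    0 ≤ restrictTo w Λ y x := by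
  unfold restrictTo; split_ifs; exacts [hw x, le_rfl]

theorem branch_nonneg (hv : ∀ x, 0 ≤ v x) (i : V) (b : Bool) (x : V → Bool) :
    0 ≤ branch v i b x := by
  unfold branch; split_ifs; exacts [hv x, le_rfl]

theorem mean_nonneg (hv : ∀ x, 0 ≤ v x) (i : V) : 0 ≤ mean v i :=
  div_nonneg (Finset.sum_nonneg fun x _ => mul_nonneg (hv x) (bit_nonneg x i))
    (Finset.sum_nonneg fun x _ => hv x)

theorem mean_le_one (hv : ∀ x, 0 ≤ v x) (i : V) : mean v i ≤ 1 :=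
  div_le_one_of_le₀ (Finset.sum_le_sum fun x _ => mul_le_of_le_one_right (hv x) (bit_le_one x i))
    (Finset.sum_nonneg fun x _ => hv x)

theorem covar_comm (v : (V → Bool) → ℝ) (i j : V) : covar v i j = covar v j i := by
  unfold covar
  rw [mul_comm (mean v i)]
  simp only [mul_comm (bit _ i)]

theorem mass_branch_true (hv : mass v ≠ 0) (i : V) : mass (branch v i true) = mass v * mean v i := by
  rw [mean, mul_div_cancel₀ _ hv, mass]
  exact Finset.sum_congr rfl fun x _ => branch_true v i x

theorem mass_branch_false (hv : mass v ≠ 0) (i : V) :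
    mass (branch v i false) = mass v * (1 - mean v i) := by
  rw [mul_sub, ← mass_branch_true hv, mul_one, eq_sub_iff_add_eq']
  simpa [mass] using sum_branch_add v i 1

theorem mean_branch_true (hv : mass v ≠ 0) {i : V} (hi : mean v i ≠ 0) (j : V) :
    mean (branch v i true) j = mean v j + covar v i j / mean v i := by
  rw [mean, mass_branch_true hv, covar]
  simp only [branch_true, mul_assoc]
  field_simp
  ring

theorem mean_branch_false (hv : mass v ≠ 0) {i : V} (hi : 1 - mean v i ≠ 0) (j : V) :
    mean (branch v i false) j = mean v j - covar v i j / (1 - mean v i) := by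
  have h : ∑ x, branch v i false x * bit x j
      = mass v * mean v j - mass v * (covar v i j + mean v i * mean v j) := by
    rw [covar, sub_add_cancel, mean, mul_div_cancel₀ _ hv, mul_div_cancel₀ _ hv,
      ← Finset.sum_sub_distrib]
    refine Finset.sum_congr rfl fun x _ => ?_
    rw [branch_false]
    ring
  rw [mean, mass_branch_false hv, h]
  field_simp
  ring

theorem mean_eq_bit {Λ : Finset V} {y : V → Bool} (h : mass (restrictTo w Λ y) ≠ 0) {j : V}
    (hj : j ∈ Λ) : mean (restrictTo w Λ y) j = bit y j := by
  rw [mean, div_eq_iff h, mass, Finset.mul_sum]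
  refine Finset.sum_congr rfl fun x _ => ?_
  unfold restrictTo
  split_ifs with hx
  · rw [bit, bit, hx j hj, mul_comm]
  · simp

theorem mean_mul_one_sub_mean_eq_zero {Λ : Finset V} {y : V → Bool}
    (h : mass (restrictTo w Λ y) ≠ 0) {j : V} (hj : j ∈ Λ) :
    mean (restrictTo w Λ y) j * (1 - mean (restrictTo w Λ y) j) = 0 := by
  rw [mean_eq_bit h hj, bit]
  split_ifs <;> simp

theorem eq_zero_of_mass_eq_zero (hv : ∀ x, 0 ≤ v x) (h : mass v = 0) (x : V → Bool) : v x = 0 :=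
  (Finset.sum_eq_zero_iff_of_nonneg fun x _ => hv x).1 h x (Finset.mem_univ x)

variable {ι : Type*} [Fintype ι] [DecidableEq ι]

/-- The conditional expectation of the exponent, with the unrevealed coordinates in `N` weighted
additionally by `α`. -/
def exponent (H : Matrix ι ι ℝ) (Y : V → Matrix ι ι ℝ) (N : Finset V) (θ α : ℝ) (p : V → ℝ) :
    Matrix ι ι ℝ :=
  H + ∑ j, ((θ + if j ∈ N then α else 0) * p j) • Y j

/-- Row `i` of the influences shifts every mean linearly in `s`, while `i` itself loses its
`α`-weight on leaving `N`; that loss is the compensator drift. -/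
theorem exponent_erase (H : Matrix ι ι ℝ) (Y : V → Matrix ι ι ℝ) {N : Finset V} (θ α : ℝ)
    {p p' : V → ℝ} {c : V → V → ℝ} {i : V} (hi : i ∈ N) {s : ℝ}
    (hp' : ∀ j, p' j = p j + s * (c i j / (p i * (1 - p i)))) :
    exponent H Y (N.erase i) θ α p' = exponent H Y N θ α p + increment Y N p c θ α i s := by
  have h1 : (α * p i) • Y i = ∑ j, (if j = i then α * p i else 0) • Y j := by
    simp [ite_smul]
  rw [exponent, exponent, increment, influenceSum, h1, add_assoc, Finset.smul_sum,
    ← Finset.sum_sub_distrib, ← Finset.sum_add_distrib]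
  congr 1
  refine Finset.sum_congr rfl fun j _ => ?_
  rw [smul_smul, ← sub_smul, ← add_smul, hp' j]
  congr 1
  by_cases hj : j = i
  · subst hj
    simp only [hi, Finset.mem_erase, ne_eq, not_true_eq_false, false_and, if_true, if_false]
    ring
  · simp only [Finset.mem_erase, ne_eq, hj, not_false_eq_true, true_and, if_false]
    ring

theorem covar_eq_zero_of_degenerate {p : V → ℝ} {c : V → V → ℝ} {D : ℝ} {i : V}
    (hc : ∑ j, |c i j| ≤ D * (p i * (1 - p i))) (h : p i * (1 - p i) = 0) (j : V) : c i j = 0 := by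
  rw [h, mul_zero] at hc
  exact abs_nonpos_iff.1 ((Finset.single_le_sum (f := fun j => |c i j|)
    (fun _ _ => abs_nonneg _) (Finset.mem_univ j)).trans hc)

open scoped MatrixOrder in
/-- The exponential moment bound under every pinning. -/
theorem sum_restrictTo_mul_trace_exp_le [Nonempty ι] (hw : ∀ x, 0 ≤ w x) {D R θ α : ℝ}
    (hcov : ∀ (Λ : Finset V) (y : V → Bool), mass (restrictTo w Λ y) ≠ 0 → ∀ i,
      ∑ j, |covar (restrictTo w Λ y) i j|
        ≤ D * (mean (restrictTo w Λ y) i * (1 - mean (restrictTo w Λ y) i)))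
    {Y : V → Matrix ι ι ℝ} (hY : ∀ j, (Y j).PosSemidef)
    (hYR : ∀ j, (R • (1 : Matrix ι ι ℝ) - Y j).PosSemidef)
    (hD : 0 ≤ D) (hR : 0 ≤ R) (hα : 0 ≤ α) (hbal : (|θ| + α) ^ 2 * D ^ 2 * R + α ^ 2 * R ≤ α)
    (hsmall : (|θ| + α) * D * R ≤ 1) {H : Matrix ι ι ℝ} (hH : H.IsHermitian) (k : ℕ) :
    ∀ (Λ : Finset V) (y : V → Bool), Λᶜ.card = k →
      ∑ x, restrictTo w Λ y x * (NormedSpace.exp (H + θ • ∑ j, bit x j • Y j)).trace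
        ≤ mass (restrictTo w Λ y)
          * (NormedSpace.exp (exponent H Y Λᶜ θ α (mean (restrictTo w Λ y)))).trace := by
  induction k with
  | zero =>
    intro Λ y hΛ
    rw [Finset.card_eq_zero] at hΛ
    by_cases h0 : mass (restrictTo w Λ y) = 0
    · simp [h0, eq_zero_of_mass_eq_zero (restrictTo_nonneg hw Λ y) h0]
    rw [mass, Finset.sum_mul]
    refine Finset.sum_le_sum fun x _ => ?_
    by_cases hx : ∀ l ∈ Λ, x l = y l
    · refine le_of_eq ?_
      congr 3
      rw [exponent, hΛ, Finset.smul_sum]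
      congr 1
      refine Finset.sum_congr rfl fun j _ => ?_
      have hj : j ∈ Λ := by
        by_contra hj
        rw [← Finset.mem_compl, hΛ] at hj
        simp at hj
      rw [mean_eq_bit h0 hj, smul_smul, bit, bit, hx j hj]
      simp
    · simp [restrictTo, hx]
  | succ k ih =>
    intro Λ y hΛ
    set v := restrictTo w Λ y with hv
    have hv0 : ∀ x, 0 ≤ v x := restrictTo_nonneg hw Λ y
    by_cases h0 : mass v = 0
    · simp [h0, eq_zero_of_mass_eq_zero hv0 h0]
    have hm0 : 0 ≤ mass v := Finset.sum_nonneg fun x _ => hv0 x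
    have hp0 := mean_nonneg hv0
    have hp1 := mean_le_one hv0
    have hc := hcov Λ y h0
    set A := exponent H Y Λᶜ θ α (mean v) with hA
    have hAh : A.IsHermitian :=
      hH.add (isHermitian_sum_smul Y (fun j => (hY j).isHermitian) _)
    have hbranch : ∀ i ∈ Λᶜ, ∑ x, v x * (NormedSpace.exp (H + θ • ∑ j, bit x j • Y j)).trace
        ≤ mass v * (mean v i
            * (NormedSpace.exp (A + increment Y Λᶜ (mean v) (covar v) θ α i (1 - mean v i))).trace
          + (1 - mean v i)
            * (NormedSpace.exp (A + increment Y Λᶜ (mean v) (covar v) θ α i (-mean v i))).trace) := by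
      intro i hi
      have hi' : i ∉ Λ := Finset.mem_compl.1 hi
      have hcard : (insert i Λ)ᶜ.card = k := by
        rw [Finset.compl_insert, Finset.card_erase_of_mem hi, hΛ, Nat.add_sub_cancel]
      have hsub (b : Bool) := ih (insert i Λ) (Function.update y i b) hcard
      simp only [← branch_restrictTo hi', ← hv, Finset.compl_insert] at hsub
      rw [← sum_branch_add v i, mul_add, ← mul_assoc, ← mul_assoc, ← mass_branch_true h0,
        ← mass_branch_false h0]
      refine add_le_add ((hsub true).trans_eq ?_) ((hsub false).trans_eq ?_)
      -- A branch of zero mass contributes nothing to either side, so its junk conditional means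
      -- never matter.
      · by_cases hi0 : mean v i = 0
        · rw [mass_branch_true h0, hi0]; simp
        · congr 3
          refine exponent_erase H Y θ α hi fun j => ?_
          rw [mean_branch_true h0 hi0]
          by_cases hi1 : 1 - mean v i = 0
          · rw [covar_eq_zero_of_degenerate (hc i) (by rw [hi1, mul_zero])]; simp
          · field_simp
      · by_cases hi0 : 1 - mean v i = 0
        · rw [mass_branch_false h0, hi0]; simp
        · congr 3
          refine exponent_erase H Y θ α hi fun j => ?_
          rw [mean_branch_false h0 hi0]
          by_cases hi1 : mean v i = 0
          · rw [covar_eq_zero_of_degenerate (hc i) (by rw [hi1, zero_mul])]; simp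
          · field_simp
            ring
    have hstep := sum_trace_exp_increment_le hY hYR hp0 hp1 (covar_comm v) hc
      (N := Λᶜ) (fun j hj => mean_mul_one_sub_mean_eq_zero h0 (by simpa using hj))
      hD hR hα hbal hsmall hAh
    have hsum := Finset.sum_le_sum hbranch
    -- The left side does not depend on `i`: summing over all unrevealed `i` and cancelling the
    -- count amounts to choosing `i` uniformly.
    rw [Finset.sum_const, nsmul_eq_mul, ← Finset.mul_sum] at hsum
    have hpos : (0 : ℝ) < Λᶜ.card := by rw [hΛ]; positivity
    refine le_of_mul_le_mul_left (hsum.trans ?_) hpos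
    calc _ ≤ mass v * (Λᶜ.card * (NormedSpace.exp A).trace) := mul_le_mul_of_nonneg_left hstep hm0
      _ = _ := by ring

end Weights

/-! ### From the measure to weights, and the tail of the quadratic form. -/

section Measure

open Matrix
open scoped MatrixOrder

variable {n d : ℕ} {μ : Measure (Fin n → Bool)}

/-- The point masses of a measure on the cube. -/
def pointMass (μ : Measure (Fin n → Bool)) (x : Fin n → Bool) : ℝ := μ.real {x}

theorem pointMass_nonneg (x : Fin n → Bool) : 0 ≤ pointMass μ x := measureReal_nonneg

theorem measureReal_eq_sum_ite [IsProbabilityMeasure μ] (P : (Fin n → Bool) → Prop)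
    [DecidablePred P] : μ.real {x | P x} = ∑ x, if P x then pointMass μ x else 0 := by
  rw [← Finset.sum_filter]
  simp only [pointMass]
  rw [sum_measureReal_singleton, Finset.coe_filter]
  simp

theorem mass_pointMass [IsProbabilityMeasure μ] : mass (pointMass μ) = 1 := by
  have h := measureReal_eq_sum_ite (μ := μ) fun _ => True
  simpa [mass] using h.symm

theorem cond_measureReal [IsProbabilityMeasure μ] (S T : Set (Fin n → Bool)) :
    (cond μ S).real T = μ.real (S ∩ T) / μ.real S := by
  rw [measureReal_def, cond_apply S.toFinite.measurableSet, ENNReal.toReal_mul, ENNReal.toReal_inv,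
    div_eq_inv_mul]
  rfl

/-- Restricting the weight to the outcomes that agree with `y` on `Λ` is pinning. -/
theorem measureReal_inter_pinned [IsProbabilityMeasure μ] (Λ : Finset (Fin n)) (y : Fin n → Bool)
    (P : (Fin n → Bool) → Prop) [DecidablePred P] :
    μ.real ({x | P x} ∩ pinned Λ fun l => y l)
      = ∑ x, if P x then restrictTo (pointMass μ) Λ y x else 0 := by
  have h : ({x | P x} ∩ pinned Λ fun l => y l) = {x | P x ∧ ∀ l ∈ Λ, x l = y l} := by
    ext x
    simp [pinned]
  rw [h, measureReal_eq_sum_ite]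
  refine Finset.sum_congr rfl fun x _ => ?_
  unfold restrictTo
  split_ifs <;> tauto

/-- Influence is covariance divided by the variance of the conditioning coordinate. For a degenerate
coordinate, where the influence is `0` by convention, the covariances vanish as well. -/
theorem sum_abs_covar_le [IsProbabilityMeasure μ] {D : ℝ} (hind : TwoSidedLinftyIndependent μ D)
    (Λ : Finset (Fin n)) (y : Fin n → Bool) (h0 : mass (restrictTo (pointMass μ) Λ y) ≠ 0)
    (i : Fin n) :
    ∑ j, |covar (restrictTo (pointMass μ) Λ y) i j|
      ≤ D * (mean (restrictTo (pointMass μ) Λ y) i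
        * (1 - mean (restrictTo (pointMass μ) Λ y) i)) := by
  set v := restrictTo (pointMass μ) Λ y with hv
  have hv0 : ∀ x, 0 ≤ v x := restrictTo_nonneg pointMass_nonneg Λ y
  have hb (b : Bool) : μ.real ({x | x i = b} ∩ pinned Λ fun l => y l) = mass (branch v i b) :=
    measureReal_inter_pinned Λ y fun x => x i = b
  have hbj (b : Bool) (j : Fin n) :
      μ.real (({x | x i = b} ∩ pinned Λ fun l => y l) ∩ {x | x j = true})
        = ∑ x, branch v i b x * bit x j := by
    rw [Set.inter_right_comm, show ({x : Fin n → Bool | x i = b} ∩ {x | x j = true})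
      = {x | x i = b ∧ x j = true} from rfl, measureReal_inter_pinned Λ y fun x => x i = b ∧ x j = true]
    refine Finset.sum_congr rfl fun x _ => ?_
    unfold branch bit
    rw [← hv]
    by_cases h1 : x i = b <;> by_cases h2 : x j = true <;> simp [h1, h2]
  have hcond (b : Bool) (j : Fin n) :
      (cond μ ({x | x i = b} ∩ pinned Λ fun l => y l)).real {x | x j = true}
        = mean (branch v i b) j := by
    rw [cond_measureReal, hb, hbj, mean]
  have hrow : ∑ j, |twoSidedInfluence μ Λ (fun l => y l) i j| ≤ D :=
    (le_ciSup (f := fun i => ∑ j, |twoSidedInfluence μ Λ (fun l => y l) i j|)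
      (Set.finite_range _).bddAbove i).trans (hind Λ fun l => y l)
  have hp0 := mean_nonneg hv0 i
  have hp1 := mean_le_one hv0 i
  by_cases hi0 : mean v i = 0
  · have hz : ∀ x, branch v i true x = 0 := eq_zero_of_mass_eq_zero
      (branch_nonneg hv0 i true)
      (by rw [mass_branch_true h0, hi0, mul_zero])
    have hcz : ∀ j, covar v i j = 0 := fun j => by
      rw [covar, hi0, zero_mul, sub_zero]
      refine div_eq_zero_iff.2 (Or.inl (Finset.sum_eq_zero fun x _ => ?_))
      rw [← mul_assoc, ← branch_true, hz, zero_mul]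
    simp [hcz, hi0]
  by_cases hi1 : 1 - mean v i = 0
  · have hz : ∀ x, branch v i false x = 0 := eq_zero_of_mass_eq_zero
      (branch_nonneg hv0 i false)
      (by rw [mass_branch_false h0, hi1, mul_zero])
    have hcz : ∀ j, covar v i j = 0 := fun j => by
      have h1 : mean v i = 1 := by linarith
      rw [covar, h1, one_mul, mean, ← sub_div, ← Finset.sum_sub_distrib]
      refine div_eq_zero_iff.2 (Or.inl (Finset.sum_eq_zero fun x _ => ?_))
      have := hz x
      rw [branch_false] at this
      linear_combination (-bit x j) * this
    simp [hcz, hi1]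
  · have hq : 0 < mean v i * (1 - mean v i) :=
      mul_pos (lt_of_le_of_ne hp0 (Ne.symm hi0))
        (lt_of_le_of_ne (sub_nonneg.2 hp1) (Ne.symm hi1))
    have hne (b : Bool) : μ ({x | x i = b} ∩ pinned Λ fun l => y l) ≠ 0 := by
      intro h
      have h2 : mass (branch v i b) = 0 := by rw [← hb, measureReal_def, h]; rfl
      cases b
      · rw [mass_branch_false h0] at h2
        exact mul_ne_zero h0 hi1 h2
      · rw [mass_branch_true h0] at h2
        exact mul_ne_zero h0 hi0 h2
    have hentry : ∀ j, twoSidedInfluence μ Λ (fun l => y l) i j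
        = covar v i j / (mean v i * (1 - mean v i)) := fun j => by
      rw [twoSidedInfluence, Matrix.of_apply, if_pos ⟨hne true, hne false⟩, hcond, hcond,
        mean_branch_true h0 hi0, mean_branch_false h0 hi1]
      field_simp
      ring
    simp_rw [hentry, abs_div, abs_of_pos hq, ← Finset.sum_div] at hrow
    exact (div_le_iff₀ hq).1 hrow

theorem restrictTo_empty (w : (Fin n → Bool) → ℝ) (y : Fin n → Bool) : restrictTo w ∅ y = w := by
  ext x
  simp [restrictTo]

theorem matSum_eq_sum_bit (Y : Fin n → Matrix (Fin d) (Fin d) ℝ) (x : Fin n → Bool) :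
    matSum Y x = ∑ j, bit x j • Y j := rfl

theorem meanMatSum_eq_sum [IsProbabilityMeasure μ] (Y : Fin n → Matrix (Fin d) (Fin d) ℝ) :
    meanMatSum μ Y = ∑ x, pointMass μ x • matSum Y x := by
  ext a b
  rw [meanMatSum, Matrix.of_apply, integral_fintype Integrable.of_finite, Matrix.sum_apply]
  rfl

theorem meanMatSum_eq_sum_mean [IsProbabilityMeasure μ] (Y : Fin n → Matrix (Fin d) (Fin d) ℝ) :
    meanMatSum μ Y = ∑ j, mean (pointMass μ) j • Y j := by
  simp_rw [meanMatSum_eq_sum, matSum_eq_sum_bit, mean, mass_pointMass, div_one, Finset.sum_smul,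
    Finset.smul_sum, smul_smul]
  exact Finset.sum_comm

theorem posSemidef_matSum {Y : Fin n → Matrix (Fin d) (Fin d) ℝ} (hY : ∀ i, (Y i).PosSemidef)
    (x : Fin n → Bool) : (matSum Y x).PosSemidef :=
  posSemidef_sum _ fun j _ => (hY j).smul (bit_nonneg x j)

theorem posSemidef_meanMatSum [IsProbabilityMeasure μ] {Y : Fin n → Matrix (Fin d) (Fin d) ℝ}
    (hY : ∀ i, (Y i).PosSemidef) : (meanMatSum μ Y).PosSemidef := by
  rw [meanMatSum_eq_sum]
  exact posSemidef_sum _ fun x _ => (posSemidef_matSum hY x).smul (pointMass_nonneg x)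

/-- The tail bound for the quadratic form of the deviation, with the sign `κ` of the deviation. -/
theorem measureReal_exists_quadraticForm_le [IsProbabilityMeasure μ] (hd : 0 < d) {D R m δ κ : ℝ}
    (hind : TwoSidedLinftyIndependent μ D) (hD : 1 ≤ D) (hR : 0 < R)
    {Y : Fin n → Matrix (Fin d) (Fin d) ℝ} (hY : ∀ j, (Y j).PosSemidef)
    (hYR : ∀ j, (R • (1 : Matrix (Fin d) (Fin d) ℝ) - Y j).PosSemidef)
    (hm : meanMatSum μ Y ≤ m • (1 : Matrix (Fin d) (Fin d) ℝ))
    (hδ : δ ∈ Set.Icc (0 : ℝ) 1) (hκ : |κ| = 1) :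
    μ.real {x | ∃ u : Fin d → ℝ, u ≠ 0 ∧
        δ * m * (u ⬝ᵥ u) ≤ u ⬝ᵥ ((κ • (matSum Y x - meanMatSum μ Y)) *ᵥ u)}
      ≤ d * Real.exp (-(δ ^ 2 * m / (20 * (R * D ^ 2)))) := by
  classical
  have : Nonempty (Fin d) := ⟨⟨0, hd⟩⟩
  obtain ⟨hδ0, hδ1⟩ := hδ
  have hD0 : 0 < D := one_pos.trans_le hD
  set M := meanMatSum μ Y with hM
  -- Once `α ≤ t`, the balance condition needs at most `(2t)² D² R + t² D² R = 5 t² D² R`, which is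
  -- taken as `α`. The chosen `t` minimizes `α - t δ`, with value `-t δ / 2`; this yields the
  -- constant `20`.
  set t := δ / (10 * (R * D ^ 2)) with ht
  set α := 5 * t ^ 2 * D ^ 2 * R with hα
  have ht0 : 0 ≤ t := by positivity
  have hα0 : 0 ≤ α := by positivity
  have htR : 10 * t * (R * D ^ 2) = δ := by rw [ht]; field_simp
  have hκt : |κ * t| = t := by rw [abs_mul, hκ, one_mul, abs_of_nonneg ht0]
  have hαt : α ≤ t := by
    have : α = t * (δ / 2) := by rw [hα, ← htR]; ring
    rw [this]
    exact mul_le_of_le_one_right ht0 (by linarith)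
  have hbal : (|κ * t| + α) ^ 2 * D ^ 2 * R + α ^ 2 * R ≤ α := by
    rw [hκt]
    have h1 : (t + α) ^ 2 * D ^ 2 * R ≤ (2 * t) ^ 2 * D ^ 2 * R := by
      gcongr
      linarith
    have h2 : α ^ 2 * R ≤ t ^ 2 * D ^ 2 * R := by
      have : (1 : ℝ) ≤ D ^ 2 := one_le_pow₀ hD
      calc α ^ 2 * R ≤ t ^ 2 * R := by gcongr
        _ ≤ _ := by
          gcongr
          exact le_mul_of_one_le_right (by positivity) this
    calc _ ≤ (2 * t) ^ 2 * D ^ 2 * R + t ^ 2 * D ^ 2 * R := add_le_add h1 h2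
      _ = α := by rw [hα]; ring
  have hsmall : (|κ * t| + α) * D * R ≤ 1 := by
    rw [hκt]
    calc (t + α) * D * R ≤ (2 * t) * D ^ 2 * R := by
          gcongr
          · linarith
          · exact le_self_pow₀ hD two_ne_zero
      _ = δ / 5 := by rw [← htR]; ring
      _ ≤ 1 := by linarith
  have hMh : M.IsHermitian := (posSemidef_meanMatSum hY).isHermitian
  have hherm (a : ℝ) : (a • M).IsHermitian := by
    rw [IsHermitian, conjTranspose_smul, hMh.eq, star_trivial]
  have hmain := sum_restrictTo_mul_trace_exp_le (w := pointMass μ) pointMass_nonneg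
    (sum_abs_covar_le hind) hY hYR hD0.le hR.le hα0 hbal hsmall (hherm (-(κ * t))) _ ∅
    (fun _ => true) rfl
  rw [restrictTo_empty, mass_pointMass, one_mul] at hmain
  -- Before anything is revealed the centering `-(κ * t) • M` cancels the mean, leaving only the
  -- compensator.
  have hexp : exponent (-(κ * t) • M) Y ∅ᶜ (κ * t) α (mean (pointMass μ)) = α • M := by
    have h : ∀ j : Fin n, ((κ * t + if j ∈ (∅ᶜ : Finset (Fin n)) then α else 0)
        * mean (pointMass μ) j) • Y j = (κ * t + α) • (mean (pointMass μ) j • Y j) := fun j => by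
      simp [smul_smul]
    rw [exponent, Finset.sum_congr rfl fun j _ => h j, ← Finset.smul_sum, ← meanMatSum_eq_sum_mean,
      ← hM]
    module
  rw [hexp] at hmain
  have hfinal : (NormedSpace.exp (α • M)).trace ≤ d * Real.exp (α * m) := by
    have h := trace_exp_le_card_mul_exp (hherm α) (m := α * m)
      (by rw [← smul_smul α m]; exact smul_le_smul_of_le hm hα0)
    simpa using h
  rw [measureReal_eq_sum_ite]
  have hmarkov : (∑ x, if ∃ u : Fin d → ℝ, u ≠ 0 ∧
        δ * m * (u ⬝ᵥ u) ≤ u ⬝ᵥ ((κ • (matSum Y x - M)) *ᵥ u) then pointMass μ x else 0)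
      * Real.exp (t * (δ * m)) ≤ d * Real.exp (α * m) := by
    refine le_trans ?_ (hmain.trans hfinal)
    rw [Finset.sum_mul]
    refine Finset.sum_le_sum fun x _ => ?_
    have hexpx : -(κ * t) • M + (κ * t) • ∑ j, bit x j • Y j = t • (κ • (matSum Y x - M)) := by
      rw [matSum_eq_sum_bit]
      module
    have hh : (t • (κ • (matSum Y x - M))).IsHermitian := by
      rw [IsHermitian, conjTranspose_smul, conjTranspose_smul, conjTranspose_sub, hMh.eq,
        (posSemidef_matSum hY x).isHermitian.eq, star_trivial, star_trivial]
    rw [hexpx]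
    split_ifs with hx
    · obtain ⟨u, hu, hxu⟩ := hx
      refine mul_le_mul_of_nonneg_left (exp_le_trace_exp hh hu ?_) (pointMass_nonneg x)
      rw [smul_mulVec, dotProduct_smul, smul_eq_mul, mul_assoc t]
      exact mul_le_mul_of_nonneg_left hxu ht0
    · rw [zero_mul]
      exact mul_nonneg (pointMass_nonneg x) (posSemidef_exp hh).trace_nonneg
  rw [← le_div_iff₀ (Real.exp_pos _), mul_div_assoc, ← Real.exp_sub] at hmarkov
  refine hmarkov.trans_eq ?_
  congr 2
  rw [hα, ht]
  field_simp
  ring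

end Measure

/-! ### Extreme eigenvalues and their eigenvectors. -/

section Eigenvalues

open Matrix
open scoped MatrixOrder

variable {d : ℕ} {A : Matrix (Fin d) (Fin d) ℝ}

theorem exists_mulVec_eq_smul (hA : A.IsHermitian) {r : ℝ} (hr : r ∈ spectrum ℝ A) :
    ∃ u : Fin d → ℝ, u ≠ 0 ∧ A *ᵥ u = r • u := by
  rw [hA.spectrum_real_eq_range_eigenvalues] at hr
  obtain ⟨i, rfl⟩ := hr
  exact ⟨hA.eigenvectorBasis i, by simpa using hA.eigenvectorBasis.toBasis.ne_zero i,
    hA.mulVec_eigenvectorBasis i⟩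

theorem spectrum_nonempty_of_isHermitian (hd : 0 < d) (hA : A.IsHermitian) :
    (spectrum ℝ A).Nonempty := by
  rw [hA.spectrum_real_eq_range_eigenvalues]
  exact ⟨_, ⟨0, hd⟩, rfl⟩

theorem exists_eigenvector_lambdaMax (hd : 0 < d) (hA : A.IsHermitian) :
    ∃ u : Fin d → ℝ, u ≠ 0 ∧ A *ᵥ u = lambdaMax A • u :=
  exists_mulVec_eq_smul hA
    ((spectrum_nonempty_of_isHermitian hd hA).csSup_mem A.finite_real_spectrum)

theorem exists_eigenvector_lambdaMin (hd : 0 < d) (hA : A.IsHermitian) :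
    ∃ u : Fin d → ℝ, u ≠ 0 ∧ A *ᵥ u = lambdaMin A • u :=
  exists_mulVec_eq_smul hA
    ((spectrum_nonempty_of_isHermitian hd hA).csInf_mem A.finite_real_spectrum)

theorem conj_diagonal_const {V : Matrix (Fin d) (Fin d) ℝ} (hV : V * Vᴴ = 1) (t : ℝ) :
    V * diagonal (fun _ => t) * Vᴴ = t • (1 : Matrix (Fin d) (Fin d) ℝ) := by
  rw [show (fun _ => t : Fin d → ℝ) = t • fun _ => 1 by ext; simp, diagonal_smul, diagonal_one,
    Matrix.mul_smul, Matrix.smul_mul, mul_one, hV]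

theorem le_lambdaMax_smul_one (hA : A.IsHermitian) :
    A ≤ lambdaMax A • (1 : Matrix (Fin d) (Fin d) ℝ) := by
  obtain ⟨V, -, h2, h3, -⟩ := exists_diagonalization hA
  have h := conj_diagonal_le_conj_diagonal V (a := hA.eigenvalues) (b := fun _ => lambdaMax A)
    fun i => le_csSup A.finite_real_spectrum.bddAbove (hA.eigenvalues_mem_spectrum_real i)
  rwa [← h3, conj_diagonal_const h2] at h

theorem lambdaMin_smul_one_le (hA : A.IsHermitian) :
    lambdaMin A • (1 : Matrix (Fin d) (Fin d) ℝ) ≤ A := by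
  obtain ⟨V, -, h2, h3, -⟩ := exists_diagonalization hA
  have h := conj_diagonal_le_conj_diagonal V (a := fun _ => lambdaMin A) (b := hA.eigenvalues)
    fun i => csInf_le A.finite_real_spectrum.bddBelow (hA.eigenvalues_mem_spectrum_real i)
  rwa [← h3, conj_diagonal_const h2] at h

theorem dotProduct_self_pos {u : Fin d → ℝ} (hu : u ≠ 0) : 0 < u ⬝ᵥ u := by
  have h : 0 < star u ⬝ᵥ u := dotProduct_star_self_pos_iff.2 hu
  rwa [star_trivial] at h

theorem nonneg_of_mulVec_eq_smul (hA : A.PosSemidef) {u : Fin d → ℝ} (hu : u ≠ 0) {r : ℝ}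
    (h : A *ᵥ u = r • u) : 0 ≤ r := by
  have h1 := hA.dotProduct_mulVec_nonneg u
  rw [h, star_trivial, dotProduct_smul, smul_eq_mul] at h1
  exact nonneg_of_mul_nonneg_left h1 (dotProduct_self_pos hu)

theorem lambdaMax_nonneg (hd : 0 < d) (hA : A.PosSemidef) : 0 ≤ lambdaMax A := by
  obtain ⟨u, hu, h⟩ := exists_eigenvector_lambdaMax hd hA.isHermitian
  exact nonneg_of_mulVec_eq_smul hA hu h

theorem lambdaMin_nonneg (hd : 0 < d) (hA : A.PosSemidef) : 0 ≤ lambdaMin A := by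
  obtain ⟨u, hu, h⟩ := exists_eigenvector_lambdaMin hd hA.isHermitian
  exact nonneg_of_mulVec_eq_smul hA hu h

theorem lambdaMax_zero (hd : 0 < d) : lambdaMax (0 : Matrix (Fin d) (Fin d) ℝ) = 0 := by
  obtain ⟨u, hu, h⟩ := exists_eigenvector_lambdaMax hd (A := 0) isHermitian_zero
  rw [zero_mulVec] at h
  exact (smul_eq_zero.1 h.symm).resolve_right hu

end Eigenvalues

/-! ### Upper and lower tails, for `D ≥ 1` and for `D < 1`. -/

section Tails

open Matrix
open scoped MatrixOrder

variable {n d : ℕ} {μ : Measure (Fin n → Bool)} {D R δ : ℝ} {Y : Fin n → Matrix (Fin d) (Fin d) ℝ}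

theorem measureReal_le_mul_exp_of_eq_zero [IsProbabilityMeasure μ] (hd : 0 < d)
    (S : Set (Fin n → Bool)) {e : ℝ} (he : e = 0) : μ.real S ≤ d * Real.exp (-e) := by
  have h1 : (1 : ℝ) ≤ d := by exact_mod_cast hd
  rw [he, neg_zero, Real.exp_zero, mul_one]
  exact measureReal_le_one.trans h1

theorem upper_tail_of_one_le [IsProbabilityMeasure μ] (hd : 0 < d)
    (hind : TwoSidedLinftyIndependent μ D) (hD : 1 ≤ D) (hR : 0 < R)
    (hY : ∀ j, (Y j).PosSemidef)
    (hYR : ∀ j, (R • (1 : Matrix (Fin d) (Fin d) ℝ) - Y j).PosSemidef)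
    (hδ : δ ∈ Set.Icc (0 : ℝ) 1) :
    μ.real {x | δ * lambdaMax (meanMatSum μ Y) ≤ lambdaMax (matSum Y x - meanMatSum μ Y)}
      ≤ d * Real.exp (-(δ ^ 2 * lambdaMax (meanMatSum μ Y) / (20 * (R * D ^ 2)))) := by
  have hM := (posSemidef_meanMatSum (μ := μ) hY).isHermitian
  refine (measureReal_mono ?_).trans (measureReal_exists_quadraticForm_le hd hind hD hR hY hYR
    (le_lambdaMax_smul_one hM) hδ (κ := 1) abs_one)
  intro x hx
  obtain ⟨u, hu, h⟩ := exists_eigenvector_lambdaMax hd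
    ((posSemidef_matSum hY x).isHermitian.sub hM)
  refine ⟨u, hu, ?_⟩
  rw [one_smul, h, dotProduct_smul, smul_eq_mul]
  exact mul_le_mul_of_nonneg_right hx (dotProduct_self_pos hu).le

theorem matSum_conj (T : Matrix (Fin d) (Fin d) ℝ) (x : Fin n → Bool) :
    matSum (fun j => Tᴴ * Y j * T) x = Tᴴ * matSum Y x * T := by
  simp only [matSum_eq_sum_bit, Finset.mul_sum, Finset.sum_mul, Matrix.mul_smul, Matrix.smul_mul]

theorem meanMatSum_conj [IsProbabilityMeasure μ] (T : Matrix (Fin d) (Fin d) ℝ) :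
    meanMatSum μ (fun j => Tᴴ * Y j * T) = Tᴴ * meanMatSum μ Y * T := by
  simp only [meanMatSum_eq_sum, matSum_conj, Finset.mul_sum, Finset.sum_mul, Matrix.mul_smul,
    Matrix.smul_mul]

theorem dotProduct_conj_mulVec (T A : Matrix (Fin d) (Fin d) ℝ) (u : Fin d → ℝ) :
    u ⬝ᵥ ((Tᴴ * A * T) *ᵥ u) = (T *ᵥ u) ⬝ᵥ (A *ᵥ (T *ᵥ u)) := by
  rw [← mulVec_mulVec, ← mulVec_mulVec, dotProduct_mulVec u, vecMul_conjTranspose, star_trivial,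
    star_trivial]

/-- Writing `M = BᴴB` and conjugating by `T = B⁻¹` gives mean `1` and matrices bounded by `R / m`,
without changing `μ`. The deviation bound with mean bound `1` then has exactly the exponent in
`λ_min(M)`. -/
theorem lower_tail_of_one_le [IsProbabilityMeasure μ] (hd : 0 < d)
    (hind : TwoSidedLinftyIndependent μ D) (hD : 1 ≤ D) (hR : 0 < R)
    (hY : ∀ j, (Y j).PosSemidef)
    (hYR : ∀ j, (R • (1 : Matrix (Fin d) (Fin d) ℝ) - Y j).PosSemidef)
    (hδ : δ ∈ Set.Icc (0 : ℝ) 1) :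
    μ.real {x | lambdaMin (matSum Y x) ≤ (1 - δ) * lambdaMin (meanMatSum μ Y)}
      ≤ d * Real.exp (-(δ ^ 2 * lambdaMin (meanMatSum μ Y) / (20 * (R * D ^ 2)))) := by
  have hMpsd := posSemidef_meanMatSum (μ := μ) hY
  set M := meanMatSum μ Y with hM
  set m := lambdaMin M with hm
  have hmin : m • (1 : Matrix (Fin d) (Fin d) ℝ) ≤ M := lambdaMin_smul_one_le hMpsd.isHermitian
  rcases (lambdaMin_nonneg hd hMpsd).eq_or_lt with h0 | h0
  · exact measureReal_le_mul_exp_of_eq_zero hd _ (by rw [hm, ← h0]; simp)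
  have hMpd : M.PosDef := by
    have h := (PosDef.one.smul h0).add_posSemidef (Matrix.le_iff.1 hmin)
    rwa [add_sub_cancel] at h
  obtain ⟨B, hB⟩ := CStarAlgebra.nonneg_iff_eq_star_mul_self.1 hMpsd.nonneg
  rw [star_eq_conjTranspose] at hB
  have hBu : IsUnit B := by
    have h := hMpd.isUnit
    rw [hB] at h
    exact isUnit_of_mul_isUnit_right h
  have hBdet : IsUnit B.det := (Matrix.isUnit_iff_isUnit_det B).1 hBu
  set T := B⁻¹ with hT
  have hBT : B * T = 1 := mul_nonsing_inv B hBdet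
  have hTB : T * B = 1 := nonsing_inv_mul B hBdet
  have hTMT : Tᴴ * M * T = 1 := by
    rw [hB, show Tᴴ * (Bᴴ * B) * T = (B * T)ᴴ * (B * T) by
      rw [conjTranspose_mul]; simp only [mul_assoc], hBT]
    simp
  have hY' : ∀ j, (Tᴴ * Y j * T).PosSemidef := fun j => (hY j).conjTranspose_mul_mul_same T
  have hYR' : ∀ j, ((R / m) • (1 : Matrix (Fin d) (Fin d) ℝ) - Tᴴ * Y j * T).PosSemidef := by
    intro j
    have h1 : ((R / m) • M - Y j).PosSemidef := by
      -- `(R / m) M - Y j` is the sum of `(R / m) (M - m)` and `R - Y j`.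
      have h2 := ((Matrix.le_iff.1 hmin).smul (div_pos hR h0).le).add (hYR j)
      rw [smul_sub, smul_smul, div_mul_cancel₀ _ h0.ne', sub_add_sub_cancel] at h2
      exact h2
    have h3 := h1.conjTranspose_mul_mul_same T
    rwa [Matrix.mul_sub, Matrix.sub_mul, Matrix.mul_smul, Matrix.smul_mul, hTMT] at h3
  have hmean : meanMatSum μ (fun j => Tᴴ * Y j * T) = 1 := by rw [meanMatSum_conj, ← hM, hTMT]
  have key := measureReal_exists_quadraticForm_le (m := 1) hd hind hD (div_pos hR h0) hY' hYR'
    (by rw [hmean, one_smul]) hδ (κ := -1) (by simp)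
  have hrhs : δ ^ 2 * 1 / (20 * (R / m * D ^ 2)) = δ ^ 2 * m / (20 * (R * D ^ 2)) := by
    have : D ≠ 0 := by linarith
    field_simp
  rw [hrhs] at key
  refine (measureReal_mono ?_).trans key
  intro x hx
  obtain ⟨u, hu, h⟩ := exists_eigenvector_lambdaMin hd (posSemidef_matSum hY x).isHermitian
  have hTBu : T *ᵥ (B *ᵥ u) = u := by rw [mulVec_mulVec, hTB, one_mulVec]
  -- In the new coordinates the minimal eigenvector `u` becomes `B u`, whose squared norm is the
  -- quadratic form of `M` at `u`, hence at least `m` times that of `u`.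
  refine ⟨B *ᵥ u, fun hBu0 => hu ?_, ?_⟩
  · rw [← hTBu, hBu0, mulVec_zero]
  have h1 : (B *ᵥ u) ⬝ᵥ (B *ᵥ u) = u ⬝ᵥ (M *ᵥ u) := by
    rw [hB, ← mulVec_mulVec, dotProduct_mulVec u, vecMul_conjTranspose, star_trivial, star_trivial]
  have h2 : m * (u ⬝ᵥ u) ≤ u ⬝ᵥ (M *ᵥ u) := by
    have h3 := dotProduct_mulVec_le_of_le hmin u
    rwa [smul_mulVec, one_mulVec, dotProduct_smul, smul_eq_mul] at h3
  have h4 : u ⬝ᵥ (matSum Y x *ᵥ u) ≤ (1 - δ) * (m * (u ⬝ᵥ u)) := by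
    rw [h, dotProduct_smul, smul_eq_mul, ← mul_assoc]
    exact mul_le_mul_of_nonneg_right hx (dotProduct_self_pos hu).le
  have h5 : (1 - δ) * (m * (u ⬝ᵥ u)) ≤ (1 - δ) * (u ⬝ᵥ (M *ᵥ u)) :=
    mul_le_mul_of_nonneg_left h2 (sub_nonneg.2 hδ.2)
  rw [hmean, matSum_conj, smul_mulVec, dotProduct_smul, sub_mulVec, dotProduct_sub,
    dotProduct_conj_mulVec, hTBu, one_mulVec, h1, smul_eq_mul]
  linarith

theorem mul_self_bit (x : Fin n → Bool) (i : Fin n) : bit x i * bit x i = bit x i := by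
  unfold bit; split_ifs <;> simp

/-- With a parameter below one the distribution is a point mass. -/
theorem matSum_eq_meanMatSum_of_lt_one [IsProbabilityMeasure μ]
    (hind : TwoSidedLinftyIndependent μ D) (hD : D < 1) {x : Fin n → Bool}
    (hx : pointMass μ x ≠ 0) : matSum Y x = meanMatSum μ Y := by
  rw [meanMatSum_eq_sum_mean, matSum_eq_sum_bit]
  refine Finset.sum_congr rfl fun i _ => ?_
  congr 1
  have hw0 : ∀ x, 0 ≤ pointMass μ x := pointMass_nonneg
  have hm : mass (pointMass μ) ≠ 0 := by rw [mass_pointMass]; exact one_ne_zero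
  have hc := sum_abs_covar_le hind ∅ x (by rwa [restrictTo_empty]) i
  rw [restrictTo_empty] at hc
  -- The diagonal covariance is the variance itself, so the row bound says variance `≤ D` times
  -- variance, forcing it to vanish when `D < 1`.
  have hii : covar (pointMass μ) i i
      = mean (pointMass μ) i * (1 - mean (pointMass μ) i) := by
    rw [covar]
    simp only [mul_self_bit]
    rw [← mean]
    ring
  have h1 := (le_abs_self _).trans ((Finset.single_le_sum
    (f := fun j => |covar (pointMass μ) i j|) (fun _ _ => abs_nonneg _) (Finset.mem_univ i)).trans hc)
  rw [hii] at h1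
  have hq : 0 ≤ mean (pointMass μ) i * (1 - mean (pointMass μ) i) :=
    mul_nonneg (mean_nonneg hw0 i) (sub_nonneg.2 (mean_le_one hw0 i))
  have hq0 : mean (pointMass μ) i * (1 - mean (pointMass μ) i) = 0 := by nlinarith
  rcases mul_eq_zero.1 hq0 with h | h
  · have hz := eq_zero_of_mass_eq_zero
      (branch_nonneg hw0 i true)
      (by rw [mass_branch_true hm, h, mul_zero]) x
    rw [branch_true] at hz
    rw [h, (mul_eq_zero.1 hz).resolve_left hx]
  · have hz := eq_zero_of_mass_eq_zero
      (branch_nonneg hw0 i false)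
      (by rw [mass_branch_false hm, h, mul_zero]) x
    rw [branch_false] at hz
    have := (mul_eq_zero.1 hz).resolve_left hx
    linarith

theorem measureReal_eq_zero_of_pointMass [IsProbabilityMeasure μ] {P : (Fin n → Bool) → Prop}
    (h : ∀ x, P x → pointMass μ x = 0) : μ.real {x | P x} = 0 := by
  classical
  rw [measureReal_eq_sum_ite]
  refine Finset.sum_eq_zero fun x _ => ?_
  split_ifs with hx
  exacts [h x hx, rfl]

/-- The sum is almost surely its mean, so the event is null unless `δ` or the eigenvalue is zero,
where the right side is `d ≥ 1`. Hence any `K` works. -/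
theorem lower_tail_of_lt_one [IsProbabilityMeasure μ] (hd : 0 < d)
    (hind : TwoSidedLinftyIndependent μ D) (hD : D < 1) (hY : ∀ j, (Y j).PosSemidef)
    (hδ : 0 ≤ δ) (K : ℝ) :
    μ.real {x | lambdaMin (matSum Y x) ≤ (1 - δ) * lambdaMin (meanMatSum μ Y)}
      ≤ d * Real.exp (-(δ ^ 2 * lambdaMin (meanMatSum μ Y) / K)) := by
  rcases hδ.eq_or_lt with h0 | h0
  · exact measureReal_le_mul_exp_of_eq_zero hd _ (by rw [← h0]; simp)
  rcases (lambdaMin_nonneg hd (posSemidef_meanMatSum (μ := μ) hY)).eq_or_lt with h1 | h1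
  · exact measureReal_le_mul_exp_of_eq_zero hd _ (by rw [← h1]; simp)
  rw [measureReal_eq_zero_of_pointMass]
  · positivity
  intro x hx
  by_contra hne
  rw [matSum_eq_meanMatSum_of_lt_one hind hD hne] at hx
  nlinarith [mul_pos h0 h1]

theorem upper_tail_of_lt_one [IsProbabilityMeasure μ] (hd : 0 < d)
    (hind : TwoSidedLinftyIndependent μ D) (hD : D < 1) (hY : ∀ j, (Y j).PosSemidef)
    (hδ : 0 ≤ δ) (K : ℝ) :
    μ.real {x | δ * lambdaMax (meanMatSum μ Y) ≤ lambdaMax (matSum Y x - meanMatSum μ Y)}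
      ≤ d * Real.exp (-(δ ^ 2 * lambdaMax (meanMatSum μ Y) / K)) := by
  rcases hδ.eq_or_lt with h0 | h0
  · exact measureReal_le_mul_exp_of_eq_zero hd _ (by rw [← h0]; simp)
  rcases (lambdaMax_nonneg hd (posSemidef_meanMatSum (μ := μ) hY)).eq_or_lt with h1 | h1
  · exact measureReal_le_mul_exp_of_eq_zero hd _ (by rw [← h1]; simp)
  rw [measureReal_eq_zero_of_pointMass]
  · positivity
  intro x hx
  by_contra hne
  rw [matSum_eq_meanMatSum_of_lt_one hind hD hne, sub_self, lambdaMax_zero hd] at hx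
  nlinarith [mul_pos h0 h1]

end Tails

end MatrixChernoff

end

theorem mainTheorem2 :
    ∃ C : ℝ, 0 < C ∧
      ∀ (n d : ℕ) (_hd : 0 < d) (μ : Measure (Fin n → Bool)) (_hμ : IsProbabilityMeasure μ)
        (D : ℝ) (_hD : 0 < D) (_hind : MatrixChernoff.TwoSidedLinftyIndependent μ D)
        (R : ℝ) (_hR : 0 < R) (Y : Fin n → Matrix (Fin d) (Fin d) ℝ)
        (_hY : ∀ i, (Y i).PosSemidef ∧ (R • (1 : Matrix (Fin d) (Fin d) ℝ) - Y i).PosSemidef)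
        (δ : ℝ) (_hδ : δ ∈ Set.Icc (0 : ℝ) 1),
        μ.real {x | MatrixChernoff.lambdaMin (MatrixChernoff.matSum Y x)
              ≤ (1 - δ) * MatrixChernoff.lambdaMin (MatrixChernoff.meanMatSum μ Y)}
            ≤ d * Real.exp (-(δ ^ 2 * MatrixChernoff.lambdaMin (MatrixChernoff.meanMatSum μ Y)
                / (C * (R * D ^ 2))))
        ∧ μ.real {x | δ * MatrixChernoff.lambdaMax (MatrixChernoff.meanMatSum μ Y)
              ≤ MatrixChernoff.lambdaMax
                  (MatrixChernoff.matSum Y x - MatrixChernoff.meanMatSum μ Y)}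
            ≤ d * Real.exp (-(δ ^ 2 * MatrixChernoff.lambdaMax (MatrixChernoff.meanMatSum μ Y)
                / (C * (R * D ^ 2)))) := by
  refine ⟨20, by norm_num, ?_⟩
  intro n d hd μ hμ D hD hind R hR Y hY δ hδ
  rcases lt_or_ge D 1 with h | h
  · exact ⟨MatrixChernoff.lower_tail_of_lt_one hd hind h (fun i => (hY i).1) hδ.1 _,
      MatrixChernoff.upper_tail_of_lt_one hd hind h (fun i => (hY i).1) hδ.1 _⟩
  · exact ⟨MatrixChernoff.lower_tail_of_one_le hd hind h hR (fun i => (hY i).1)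
        (fun i => (hY i).2) hδ,
      MatrixChernoff.upper_tail_of_one_le hd hind h hR (fun i => (hY i).1)
        (fun i => (hY i).2) hδ⟩
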